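/- Let $\mathcal H$ be a complex Hilbert space of finite dimension $d\ge 2$, let $\mathcal L(\mathcal H)_+$ be the set of positive semidefinite operators on $\mathcal H$, and let $I$ be the identity operator. For $A\in\mathcal L(\mathcal H)_+$ let $\operatorname{supp}A=(\ker A)^\perp$, and let $\hat{\log}A$ be obtained from the functional calculus with $\hat{\log}(t)=\log t$ for $t>0$ and $\hat{\log}(0)=0$. For $A,B\in\mathcal L(\mathcal H)_+$ let $P_{A,B}$ be the orthogonal projection onto $\operatorname{supp}A\cap\operatorname{supp}B$. The Log-Euclidean mean of $A$ and $B$ is \[ A\diamond B=P_{A,B}\exp\left(\frac{P_{A,B}(\hat{\log}A)P_{A,B}+P_{A,B}(\hat{\log}B)P_{A,B}}{2}\right)P_{A,B}, \] and their logarithmic product is \[ A\odot B=\lim_{n\to\infty}\left(A^{1/n}B^{1/n}\right)^n . \] Let $\phi:\mathcal L(\mathcal H)_+\to\mathcal L(\mathcal H)_+$ be a bijective map such that \[ \phi(A\diamond B)=\phi(A)\diamond\phi(B)\qquad\text{for all }A,B\in\mathcal L(\mathcal H)_+ , \] and assume that $\phi$ is continuous at $0$ (for the usual topology on operators, restricted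 to $\mathcal L(\mathcal H)_+$). Then there exists an invertible operator $T$ on $\mathcal H$, either linear or conjugate-linear, such that for every $A\in\mathcal L(\mathcal H)_+$ \[ \phi(A)=\phi(I)\odot\left(P_{T,A}\exp\left(P_{T,A}\,T(\hat{\log}A)T^*\,P_{T,A}\right)P_{T,A}\right), \] where the limit defining $\odot$ exists and $P_{T,A}$ is the orthogonal projection onto $(T(\ker A))^\perp$. Here $T^*$ is the adjoint of $T$; for conjugate-linear $T$ it is the conjugate-linear operator with $\langle Tx,y\rangle=\overline{\langle x,T^*y\rangle}$ for all $x,y\in\mathcal H$. -/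

import Mathlib

noncomputable section

open Filter Topology
open scoped InnerProductSpace

namespace LogEuclidean

variable {H : Type*} [NormedAddCommGroup H] [InnerProductSpace ℂ H] [CompleteSpace H]

/-- The set of positive semidefinite operators on `H` (Loewner order), with the topology inherited
from the operators on `H`. -/
abbrev PSD (H : Type*) [NormedAddCommGroup H] [InnerProductSpace ℂ H] : Type _ :=
  {A : H →L[ℂ] H // 0 ≤ A}

/-- The zero operator. -/
def PSD.zero : PSD H := ⟨0, le_rfl⟩

/-- The identity operator. -/
def PSD.one : PSD H := ⟨1, zero_le_one⟩

/-- The function equal to `log t` for `t > 0` and to `0` at `t = 0` (the values at `t < 0` play no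
role). -/
def logHatFun (t : ℝ) : ℝ := if 0 < t then Real.log t else 0

/-- The extended logarithm of an operator, through the functional calculus. -/
def logHat (A : H →L[ℂ] H) : H →L[ℂ] H := cfc logHatFun A

theorem logHat_isSelfAdjoint (A : H →L[ℂ] H) : IsSelfAdjoint (logHat A) :=
  cfc_predicate _ _

/-- The support of a self-adjoint operator: the orthogonal complement of its kernel. -/
def supp (A : H →L[ℂ] H) : Submodule ℂ H := (LinearMap.ker (A : H →ₗ[ℂ] H))ᗮ

/-- `C` is the logarithmic product of the positive semidefinite operators `A` and `B`, that is,
`C = lim (A ^ (1 / n) * B ^ (1 / n)) ^ n` as `n → ∞`. -/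
def IsLogProduct (A B C : H →L[ℂ] H) : Prop :=
  Tendsto (fun n : ℕ => (A ^ (1 / (n : ℝ)) * B ^ (1 / (n : ℝ))) ^ n) atTop (𝓝 C)

/-- The adjoint of a conjugate-linear operator; see `conjAdjoint_inner`. -/
def conjAdjoint (T : H →L⋆[ℂ] H) : H →L⋆[ℂ] H where
  toFun y := (InnerProductSpace.toDual ℂ H).symm (((innerSL ℂ).flip y).comp T)
  map_add' y z := by simp [ContinuousLinearMap.add_comp]
  map_smul' c y := by
    rw [map_smul, ContinuousLinearMap.smul_comp]
    exact (InnerProductSpace.toDual ℂ H).symm.map_smulₛₗ c _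
  cont := by
    refine (InnerProductSpace.toDual ℂ H).symm.continuous.comp ?_
    exact ((ContinuousLinearMap.compSL H H ℂ (starRingEnd ℂ) (starRingEnd ℂ)).flip T).continuous.comp
      (innerSL ℂ).flip.continuous

/-- The defining property of the adjoint of a conjugate-linear operator. -/
theorem conjAdjoint_inner (T : H →L⋆[ℂ] H) (x y : H) : ⟪conjAdjoint T y, x⟫_ℂ = ⟪T x, y⟫_ℂ := by
  simp [conjAdjoint]

variable [FiniteDimensional ℂ H]

/-- The orthogonal projection onto `supp A ∩ supp B`. -/
def meetProj (A B : H →L[ℂ] H) : H →L[ℂ] H := (supp A ⊓ supp B).starProjection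

/-- The Log-Euclidean mean as an operator. -/
def meanOp (A B : H →L[ℂ] H) : H →L[ℂ] H :=
  meetProj A B *
    NormedSpace.exp ((2⁻¹ : ℝ) • (meetProj A B * logHat A * meetProj A B +
      meetProj A B * logHat B * meetProj A B)) *
    meetProj A B

theorem meetProj_isSelfAdjoint (A B : H →L[ℂ] H) : IsSelfAdjoint (meetProj A B) :=
  isSelfAdjoint_starProjection _

theorem meanOp_nonneg (A B : H →L[ℂ] H) : 0 ≤ meanOp A B := by
  have hP := meetProj_isSelfAdjoint A B
  have h : ∀ X : H →L[ℂ] H, IsSelfAdjoint X →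
      IsSelfAdjoint (meetProj A B * X * meetProj A B) := fun X hX => by
    have := hX.conjugate (meetProj A B)
    rwa [hP.star_eq] at this
  have hX : IsSelfAdjoint ((2⁻¹ : ℝ) • (meetProj A B * logHat A * meetProj A B +
      meetProj A B * logHat B * meetProj A B)) :=
    IsSelfAdjoint.smul (IsSelfAdjoint.all _)
      ((h _ (logHat_isSelfAdjoint A)).add (h _ (logHat_isSelfAdjoint B)))
  have := star_right_conjugate_nonneg hX.exp_nonneg (meetProj A B)
  rwa [hP.star_eq] at this

/-- The Log-Euclidean mean of positive semidefinite operators. -/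
def mean (A B : PSD H) : PSD H := ⟨meanOp A.1 B.1, meanOp_nonneg A.1 B.1⟩

/-- For a subspace `K` and an operator `X`, the operator `P exp (P X P) P`, where `P` is the
orthogonal projection onto the orthogonal complement of `K`. -/
def compressedExp (K : Submodule ℂ H) (X : H →L[ℂ] H) : H →L[ℂ] H :=
  Kᗮ.starProjection * NormedSpace.exp (Kᗮ.starProjection * X * Kᗮ.starProjection) *
    Kᗮ.starProjection

/-- For linear invertible `T`: the operator `P exp (P T (logHat A) T* P) P`, where `P` is the
orthogonal projection onto `(T (ker A))ᗮ`. -/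
def linTransform (T : H ≃L[ℂ] H) (A : H →L[ℂ] H) : H →L[ℂ] H :=
  compressedExp ((LinearMap.ker (A : H →ₗ[ℂ] H)).map (T.toLinearEquiv : H →ₗ[ℂ] H))
    ((T : H →L[ℂ] H).comp ((logHat A).comp (ContinuousLinearMap.adjoint (T : H →L[ℂ] H))))

/-- For conjugate-linear invertible `T`: the operator `P exp (P T (logHat A) T* P) P`, where `P` is
the orthogonal projection onto `(T (ker A))ᗮ`. -/
def conjTransform (T : H ≃L⋆[ℂ] H) (A : H →L[ℂ] H) : H →L[ℂ] H :=
  compressedExp ((LinearMap.ker (A : H →ₗ[ℂ] H)).map (T.toLinearEquiv : H →ₗ⋆[ℂ] H))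
    ((T : H →L⋆[ℂ] H).comp ((logHat A).comp (conjAdjoint (T : H →L⋆[ℂ] H))))

end LogEuclidean

end

noncomputable section

open Filter Topology
open scoped InnerProductSpace

namespace LogEuclidean

set_option linter.unusedSectionVars false

variable {H : Type*} [NormedAddCommGroup H] [InnerProductSpace ℂ H] [CompleteSpace H]
  [FiniteDimensional ℂ H]

/-! A positive operator is the same thing as a pair: its support and its extended logarithm, a
self-adjoint operator living on that support (`expOn_logHat`, `logHat_expOn`, `supp_expOn`). In
these coordinates the mean intersects supports and averages logarithms after compression. Hence
`supp A ≤ supp B` is expressible through the mean alone (`supp_le_iff_exists_mean`), so φ preserves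
and reflects inclusion of supports; and if `X` compresses to the logarithm of `A`, then `A` absorbs
`exp X` under the mean, so `log φ(A)` is the compression of `log φ(exp X)`
(`logHat_map_eq_compress`). Everything reduces to `G(X) = log φ(exp X) - log φ(I)`.

Each line `ℂ y` is the support of images of operators supported on some line `ℂ x`. Compressing to
these lines shows that `⟪y, G(X) y⟫` depends only on `⟪x, X x⟫`, through a function satisfying the
midpoint equation. Continuity of φ at 0 makes this function linear with positive slope, so `⟪y, G(X)
y⟫ = ⟪S y, X (S y)⟫` for some vector `S y` (`exists_inner_logHat_map`).

`S y` is determined only up to a phase. Comparing the forms at `x + s • e` for all complex `s` shows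
that the phases can be fixed so that `S` becomes linear or conjugate-linear (`polar_form_eq`,
`exists_linear_congruence`). Its adjoint is the required operator, and a Lie–Trotter formula with a
projection (`isLogProduct_expOn`) turns the sum of logarithms into the logarithmic product. -/

/-! ### Functional calculus on eigenvectors. -/

theorem finite_spectrum_real (A : H →L[ℂ] H) : (spectrum ℝ A).Finite := by
  have hq : IsIntegral ℂ A := Algebra.IsIntegral.isIntegral A
  have h : (spectrum ℂ A).Finite := by
    refine (minpoly ℂ A).rootSet_finite ℂ |>.subset fun z hz => ?_
    have h1 := spectrum.subset_polynomial_aeval A (minpoly ℂ A) ⟨z, hz, rfl⟩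
    have : Nontrivial (H →L[ℂ] H) := by
      by_contra hn
      rw [not_nontrivial_iff_subsingleton] at hn
      simp [spectrum.of_subsingleton] at hz
    rw [minpoly.aeval, spectrum.zero_eq, Set.mem_singleton_iff] at h1
    rw [Polynomial.mem_rootSet]
    exact ⟨minpoly.ne_zero hq, by simpa using h1⟩
  refine (h.preimage (f := algebraMap ℝ ℂ) (FaithfulSMul.algebraMap_injective ℝ ℂ).injOn).subset
    fun r hr => ?_
  exact spectrum.algebraMap_mem ℂ hr

theorem aeval_apply_of_eigen {A : H →L[ℂ] H} {v : H} {r : ℝ} (h : A v = (r : ℂ) • v)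
    (p : Polynomial ℝ) : Polynomial.aeval A p v = ((p.eval r : ℝ) : ℂ) • v := by
  induction p using Polynomial.induction_on' with
  | add p q hp hq => simp [hp, hq, add_smul]
  | monomial n c =>
    have hpow : (A ^ n) v = ((r ^ n : ℝ) : ℂ) • v := by
      induction n with
      | zero => simp
      | succ n ih => rw [pow_succ, mul_apply_eq_comp, h, map_smul, ih, smul_smul]
                     push_cast; ring_nf
    rw [Polynomial.aeval_monomial, Polynomial.eval_monomial, mul_apply_eq_comp, hpow,
      Algebra.algebraMap_eq_smul_one]
    rw [smul_apply, one_apply_eq_self, Complex.ofReal_mul, mul_smul, Complex.coe_smul,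
      Complex.coe_smul]

/-- The spectrum is finite, so `f` may be replaced by an interpolating polynomial; no continuity is
needed, which matters for `logHatFun`, discontinuous at 0. -/
theorem cfc_apply_of_eigen {A : H →L[ℂ] H} (hA : IsSelfAdjoint A) (f : ℝ → ℝ) {v : H} {r : ℝ}
    (h : A v = (r : ℂ) • v) : cfc f A v = (f r : ℂ) • v := by
  classical
  -- Adding `r` as a node also covers `v = 0`, where `r` need not be in the spectrum.
  set s : Finset ℝ := insert r (finite_spectrum_real A).toFinset
  have hp : ∀ t ∈ s, (Lagrange.interpolate s id f).eval t = f t := fun t ht =>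
    Lagrange.eval_interpolate_at_node f (v := id) Function.injective_id.injOn ht
  have h1 : cfc f A = Polynomial.aeval A (Lagrange.interpolate s id f) := by
    rw [← cfc_polynomial _ A hA]
    exact cfc_congr fun t ht => (hp t (by simp [s, ht])).symm
  rw [h1, aeval_apply_of_eigen h, hp r (by simp [s])]

theorem eigen_ext {X : H →L[ℂ] H} (hX : IsSelfAdjoint X) {B C : H →L[ℂ] H}
    (h : ∀ (v : H) (r : ℝ), X v = (r : ℂ) • v → B v = C v) : B = C := by
  have hs := hX.isSymmetric
  have : (B : H →ₗ[ℂ] H) = C := by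
    refine (hs.eigenvectorBasis rfl).toBasis.ext fun i => ?_
    simpa using h _ _ (hs.apply_eigenvectorBasis rfl i)
  ext v
  exact LinearMap.congr_fun this v

theorem exp_apply_of_eigen {X : H →L[ℂ] H} (hX : IsSelfAdjoint X) {v : H} {r : ℝ}
    (h : X v = (r : ℂ) • v) : NormedSpace.exp X v = (Real.exp r : ℂ) • v := by
  rw [← CFC.real_exp_eq_normedSpace_exp hX]
  simpa using cfc_apply_of_eigen hX Real.exp h

/-! ### Supports, compressions and exponentials on a subspace. -/

theorem ker_eq_orthogonal_supp (A : H →L[ℂ] H) :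
    (supp A)ᗮ = LinearMap.ker (A : H →ₗ[ℂ] H) := Submodule.orthogonal_orthogonal _

theorem apply_mem_supp {A : H →L[ℂ] H} (hA : IsSelfAdjoint A) (v : H) : A v ∈ supp A := by
  rw [supp, Submodule.mem_orthogonal]
  intro u hu
  have := hA.isSymmetric u v
  simp only [ContinuousLinearMap.coe_coe] at this
  rw [← this, show A u = 0 from hu, inner_zero_left]

/-- The compression of an operator to a subspace. -/
def compress (K : Submodule ℂ H) (X : H →L[ℂ] H) : H →L[ℂ] H :=
  K.starProjection * X * K.starProjection

theorem compress_isSelfAdjoint (K : Submodule ℂ H) {X : H →L[ℂ] H} (hX : IsSelfAdjoint X) :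
    IsSelfAdjoint (compress K X) := by
  have hP : IsSelfAdjoint K.starProjection := isSelfAdjoint_starProjection _
  have := hX.conjugate K.starProjection
  rwa [hP.star_eq] at this

theorem compress_add (K : Submodule ℂ H) (X Y : H →L[ℂ] H) :
    compress K (X + Y) = compress K X + compress K Y := by
  simp [compress, mul_add, add_mul]

theorem compress_smul (K : Submodule ℂ H) (c : ℝ) (X : H →L[ℂ] H) :
    compress K (c • X) = c • compress K X := by
  simp [compress]

theorem compress_compress {K L : Submodule ℂ H} (h : K ≤ L) (X : H →L[ℂ] H) :
    compress K (compress L X) = compress K X := by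
  have h1 : K.starProjection * L.starProjection = K.starProjection :=
    Submodule.starProjection_comp_starProjection_of_le h
  have h2 : L.starProjection * K.starProjection = K.starProjection := by
    ext v
    exact Submodule.starProjection_eq_self_iff.2 (h (Submodule.starProjection_apply_mem K v))
  calc K.starProjection * (L.starProjection * X * L.starProjection) * K.starProjection
      = (K.starProjection * L.starProjection) * X * (L.starProjection * K.starProjection) := by
        simp only [mul_assoc]
    _ = _ := by rw [h1, h2, compress]

theorem compress_apply_mem (K : Submodule ℂ H) (X : H →L[ℂ] H) (v : H) : compress K X v ∈ K :=
  Submodule.starProjection_apply_mem K _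

theorem compress_apply_starProjection (K : Submodule ℂ H) (X : H →L[ℂ] H) (v : H) :
    compress K X (K.starProjection v) = compress K X v := by
  have hP : K.starProjection (K.starProjection v) = K.starProjection v :=
    Submodule.starProjection_eq_self_iff.2 (Submodule.starProjection_apply_mem K v)
  simp [compress, hP]

theorem compress_apply_of_mem_orthogonal {K : Submodule ℂ H} (X : H →L[ℂ] H) {v : H}
    (hv : v ∈ Kᗮ) : compress K X v = 0 := by
  simp [compress, (Submodule.starProjection_apply_eq_zero_iff K).2 hv]

theorem starProjection_compress_apply (K : Submodule ℂ H) (X : H →L[ℂ] H) (v : H) :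
    K.starProjection (compress K X v) = compress K X v :=
  Submodule.starProjection_eq_self_iff.2 (compress_apply_mem K X v)

theorem inner_compress_apply_self {K : Submodule ℂ H} (X : H →L[ℂ] H) {v : H} (hv : v ∈ K) :
    ⟪v, compress K X v⟫_ℂ = ⟪v, X v⟫_ℂ := by
  have hP : K.starProjection v = v := Submodule.starProjection_eq_self_iff.2 hv
  simp only [compress, mul_apply_eq_comp]
  rw [← Submodule.inner_starProjection_left_eq_right, hP]

theorem compress_top (X : H →L[ℂ] H) : compress ⊤ X = X := by
  ext v
  have hP : ∀ w : H, (⊤ : Submodule ℂ H).starProjection w = w := fun w =>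
    Submodule.starProjection_eq_self_iff.2 Submodule.mem_top
  simp [compress, hP]

/-- The operator with support `K` whose logarithm is the compression of `X` to `K`. -/
def expOn (K : Submodule ℂ H) (X : H →L[ℂ] H) : H →L[ℂ] H :=
  K.starProjection * NormedSpace.exp (compress K X) * K.starProjection

theorem expOn_compress (K : Submodule ℂ H) (X : H →L[ℂ] H) :
    expOn K (compress K X) = expOn K X := by
  rw [expOn, compress_compress le_rfl, expOn]

theorem meanOp_eq_expOn (A B : H →L[ℂ] H) :
    meanOp A B = expOn (supp A ⊓ supp B) ((2⁻¹ : ℝ) • (logHat A + logHat B)) := by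
  rw [expOn, compress_smul, compress_add]; rfl

theorem expOn_nonneg (K : Submodule ℂ H) {X : H →L[ℂ] H} (hX : IsSelfAdjoint X) :
    0 ≤ expOn K X := by
  have hP : IsSelfAdjoint K.starProjection := isSelfAdjoint_starProjection _
  have := star_right_conjugate_nonneg (compress_isSelfAdjoint K hX).exp_nonneg K.starProjection
  rwa [hP.star_eq] at this

theorem expOn_apply_of_mem_orthogonal {K : Submodule ℂ H} (X : H →L[ℂ] H) {v : H}
    (hv : v ∈ Kᗮ) : expOn K X v = 0 := by
  simp [expOn, (Submodule.starProjection_apply_eq_zero_iff K).2 hv]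

theorem expOn_apply_of_eigen {K : Submodule ℂ H} {X : H →L[ℂ] H} (hX : IsSelfAdjoint X) {v : H}
    {r : ℝ} (hv : v ∈ K) (h : compress K X v = (r : ℂ) • v) :
    expOn K X v = (Real.exp r : ℂ) • v := by
  have hP : K.starProjection v = v := Submodule.starProjection_eq_self_iff.2 hv
  simp only [expOn, mul_apply_eq_comp]
  rw [hP, exp_apply_of_eigen (compress_isSelfAdjoint K hX) h, map_smul, hP]

/-- The compression commutes with the projection onto `K`, so the `K`-component of an eigenvector is
again an eigenvector; this lets eigenvectors in `K` and vectors of `Kᗮ` be tested separately. -/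
theorem eigen_compress_ext {K : Submodule ℂ H} {X : H →L[ℂ] H} (hX : IsSelfAdjoint X)
    {B C : H →L[ℂ] H} (h0 : ∀ v ∈ Kᗮ, B v = C v)
    (h : ∀ v ∈ K, ∀ r : ℝ, compress K X v = (r : ℂ) • v → B v = C v) : B = C := by
  refine eigen_ext (compress_isSelfAdjoint K hX) fun v r hv => ?_
  have h1 : compress K X (K.starProjection v) = (r : ℂ) • K.starProjection v := by
    rw [compress_apply_starProjection, ← starProjection_compress_apply, hv, map_smul]
  have h2 := h _ (Submodule.starProjection_apply_mem K v) r h1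
  have h3 := h0 (v - K.starProjection v) (Submodule.sub_starProjection_mem_orthogonal v)
  rw [map_sub, map_sub, h2] at h3
  exact sub_left_injective h3

theorem logHat_apply_of_eigen {A : H →L[ℂ] H} (hA : 0 ≤ A) {v : H} {r : ℝ}
    (h : A v = (r : ℂ) • v) : logHat A v = (logHatFun r : ℂ) • v :=
  cfc_apply_of_eigen (IsSelfAdjoint.of_nonneg hA) _ h

theorem logHat_expOn (K : Submodule ℂ H) {X : H →L[ℂ] H} (hX : IsSelfAdjoint X) :
    logHat (expOn K X) = compress K X := by
  refine eigen_compress_ext hX (K := K) (fun v hv => ?_) fun v hv r h => ?_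
  · rw [compress_apply_of_mem_orthogonal X hv,
      logHat_apply_of_eigen (expOn_nonneg K hX) (r := 0)
        (by simp [expOn_apply_of_mem_orthogonal X hv])]
    simp [logHatFun]
  · rw [h, logHat_apply_of_eigen (expOn_nonneg K hX) (expOn_apply_of_eigen hX hv h)]
    simp [logHatFun, Real.exp_pos]

theorem supp_expOn (K : Submodule ℂ H) {X : H →L[ℂ] H} (hX : IsSelfAdjoint X) :
    supp (expOn K X) = K := by
  -- `expOn K (-X)` inverts `expOn K X` on `K`, so the kernel is no larger than `Kᗮ`.
  have hinv : expOn K (-X) * expOn K X = K.starProjection := by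
    refine eigen_compress_ext hX (K := K) (fun v hv => ?_) fun v hv r h => ?_
    · simp [expOn_apply_of_mem_orthogonal X hv, (Submodule.starProjection_apply_eq_zero_iff K).2 hv]
    · have h' : compress K (-X) v = ((-r : ℝ) : ℂ) • v := by
        have : compress K (-X) = - compress K X := by simp [compress]
        simp [this, h]
      rw [mul_apply_eq_comp, expOn_apply_of_eigen hX hv h, map_smul,
        expOn_apply_of_eigen hX.neg hv h', smul_smul, ← Complex.ofReal_mul, ← Real.exp_add]
      simpa using (Submodule.starProjection_eq_self_iff.2 hv).symm
  have : LinearMap.ker (expOn K X : H →ₗ[ℂ] H) = Kᗮ := by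
    ext v
    refine ⟨fun h => ?_, fun h => expOn_apply_of_mem_orthogonal X h⟩
    have h : expOn K X v = 0 := h
    rw [← Submodule.starProjection_apply_eq_zero_iff, ← hinv, mul_apply_eq_comp, h,
      map_zero]
  rw [supp, this, Submodule.orthogonal_orthogonal]

theorem eigenvalue_pos_or_mem_ker {A : H →L[ℂ] H} (hA : 0 ≤ A) {v : H} {r : ℝ}
    (h : A v = (r : ℂ) • v) : v ∈ (supp A)ᗮ ∨ (0 < r ∧ v ∈ supp A) := by
  rcases lt_trichotomy r 0 with hr | hr | hr
  · left
    have h1 := ((ContinuousLinearMap.nonneg_iff_isPositive A).1 hA).re_inner_nonneg_right v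
    rw [h, inner_smul_right, inner_self_eq_norm_sq_to_K] at h1
    have h2 : 0 ≤ r * ‖v‖ ^ 2 := by
      convert h1
      change _ = ((r : ℂ) * (‖v‖ : ℂ) ^ 2).re
      rw [← Complex.ofReal_pow, ← Complex.ofReal_mul, Complex.ofReal_re]
    have h3 : v = 0 := by
      rw [← norm_eq_zero]
      by_contra hn
      have : 0 < ‖v‖ ^ 2 := by positivity
      nlinarith
    simp [h3]
  · left
    rw [ker_eq_orthogonal_supp, LinearMap.mem_ker]
    simpa [hr] using h
  · right
    refine ⟨hr, ?_⟩
    have : v = ((r⁻¹ : ℝ) : ℂ) • A v := by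
      rw [h, smul_smul, ← Complex.ofReal_mul, inv_mul_cancel₀ hr.ne']; simp
    rw [this]
    exact Submodule.smul_mem _ _ (apply_mem_supp (IsSelfAdjoint.of_nonneg hA) v)

theorem logHat_apply_of_mem_orthogonal_supp {A : H →L[ℂ] H} (hA : 0 ≤ A) {v : H}
    (hv : v ∈ (supp A)ᗮ) : logHat A v = 0 := by
  rw [ker_eq_orthogonal_supp, LinearMap.mem_ker] at hv
  rw [logHat_apply_of_eigen hA (r := 0) (by simpa using hv)]
  simp [logHatFun]

theorem compress_logHat {A : H →L[ℂ] H} (hA : 0 ≤ A) : compress (supp A) (logHat A) = logHat A := by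
  refine eigen_ext (IsSelfAdjoint.of_nonneg hA) fun v r h => ?_
  rcases eigenvalue_pos_or_mem_ker hA h with hv | ⟨-, hv⟩
  · rw [compress_apply_of_mem_orthogonal _ hv, logHat_apply_of_mem_orthogonal_supp hA hv]
  · have hP : (supp A).starProjection v = v := Submodule.starProjection_eq_self_iff.2 hv
    simp [compress, hP, logHat_apply_of_eigen hA h]

theorem expOn_logHat {A : H →L[ℂ] H} (hA : 0 ≤ A) : expOn (supp A) (logHat A) = A := by
  refine eigen_ext (IsSelfAdjoint.of_nonneg hA) fun v r h => ?_
  rcases eigenvalue_pos_or_mem_ker hA h with hv | ⟨hr, hv⟩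
  · rw [expOn_apply_of_mem_orthogonal _ hv]
    rw [ker_eq_orthogonal_supp, LinearMap.mem_ker] at hv
    exact hv.symm
  · rw [expOn_apply_of_eigen (logHat_isSelfAdjoint A) hv (r := Real.log r), h, Real.exp_log hr]
    rw [compress_logHat hA, logHat_apply_of_eigen hA h, logHatFun, if_pos hr]

/-- The exponent 0 is excluded because `0 ^ 0 = 1` would give the identity instead of the projection
onto `K`. -/
theorem rpow_expOn (K : Submodule ℂ H) {X : H →L[ℂ] H} (hX : IsSelfAdjoint X) {t : ℝ}
    (ht : t ≠ 0) : expOn K X ^ t = expOn K (t • X) := by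
  have h0 := expOn_nonneg K hX
  rw [CFC.rpow_eq_cfc_real h0]
  refine eigen_compress_ext hX (K := K) (fun v hv => ?_) fun v hv r h => ?_
  · rw [expOn_apply_of_mem_orthogonal _ hv, cfc_apply_of_eigen (IsSelfAdjoint.of_nonneg h0) _ (r := 0)
        (by simp [expOn_apply_of_mem_orthogonal X hv])]
    simp [Real.zero_rpow ht]
  · have h' : compress K (t • X) v = ((r * t : ℝ) : ℂ) • v := by
      rw [compress_smul, smul_apply, h, ← Complex.coe_smul, smul_smul,
        mul_comm r, Complex.ofReal_mul]
    rw [expOn_apply_of_eigen (IsSelfAdjoint.smul (IsSelfAdjoint.all t) hX) hv h',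
      cfc_apply_of_eigen (IsSelfAdjoint.of_nonneg h0) _ (expOn_apply_of_eigen hX hv h), Real.exp_mul]

/-! ### A Lie–Trotter formula with a projection. -/

theorem norm_pow_le_of_norm_le {a : H →L[ℂ] H} {M : ℝ} (ha : ‖a‖ ≤ M) (n : ℕ) :
    ‖a ^ n‖ ≤ M ^ n := by
  induction n with
  | zero =>
    rw [pow_zero, pow_zero]
    exact ContinuousLinearMap.norm_id_le
  | succ n ih =>
    rw [pow_succ, pow_succ]
    exact (norm_mul_le _ _).trans
      (mul_le_mul ih ha (norm_nonneg _) (pow_nonneg ((norm_nonneg _).trans ha) _))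

theorem norm_pow_sub_pow_le {a b : H →L[ℂ] H} {M : ℝ} (hM : 1 ≤ M) (ha : ‖a‖ ≤ M) (hb : ‖b‖ ≤ M)
    (n : ℕ) : ‖a ^ n - b ^ n‖ ≤ n * M ^ n * ‖a - b‖ := by
  have hM0 : 0 ≤ M := by linarith
  induction n with
  | zero => simp
  | succ n ih =>
    have h : a ^ (n + 1) - b ^ (n + 1) = a ^ n * (a - b) + (a ^ n - b ^ n) * b := by
      simp only [pow_succ]; noncomm_ring
    have h1 : ‖a ^ n * (a - b)‖ ≤ M ^ (n + 1) * ‖a - b‖ := by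
      refine (norm_mul_le _ _).trans (mul_le_mul_of_nonneg_right ?_ (norm_nonneg _))
      exact (norm_pow_le_of_norm_le ha n).trans (pow_le_pow_right₀ hM n.le_succ)
    have h2 : ‖(a ^ n - b ^ n) * b‖ ≤ n * M ^ n * ‖a - b‖ * M :=
      (norm_mul_le _ _).trans (mul_le_mul ih hb (norm_nonneg _) (by positivity))
    calc _ ≤ ‖a ^ n * (a - b)‖ + ‖(a ^ n - b ^ n) * b‖ := h ▸ norm_add_le _ _
      _ ≤ M ^ (n + 1) * ‖a - b‖ + n * M ^ n * ‖a - b‖ * M := add_le_add h1 h2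
      _ = _ := by push_cast; ring

theorem tendsto_smul_exp_sub_one (X : H →L[ℂ] H) {t : ℕ → ℝ} (ht : Tendsto t atTop (𝓝 0))
    (ht0 : ∀ᶠ n in atTop, t n ≠ 0) (hnt : Tendsto (fun n : ℕ => n * t n) atTop (𝓝 1)) :
    Tendsto (fun n : ℕ => (n : ℝ) • (NormedSpace.exp (t n • X) - 1)) atTop (𝓝 X) := by
  have h := (hasDerivAt_exp_smul_const (𝕂 := ℝ) X 0).tendsto_slope_zero
  simp only [zero_smul, NormedSpace.exp_zero, one_mul, zero_add] at h
  have h1 := hnt.smul (h.comp (tendsto_nhdsWithin_iff.2 ⟨ht, ht0⟩))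
  rw [one_smul] at h1
  refine h1.congr' ?_
  filter_upwards [ht0] with n hn
  simp only [Function.comp_apply]
  rw [smul_smul, mul_assoc, mul_inv_cancel₀ hn, mul_one]

/-- Compare `w n` with `exp (Z / n)`, whose `n`-th power is `exp Z`: the telescoping bound is `n * M
^ n * ‖w n - v n‖`, where `n * ‖w n - v n‖ → 0`. -/
theorem tendsto_pow_exp {w : ℕ → H →L[ℂ] H} {Z : H →L[ℂ] H}
    (hw : Tendsto (fun n : ℕ => (n : ℝ) • (w n - 1)) atTop (𝓝 Z)) :
    Tendsto (fun n : ℕ => w n ^ n) atTop (𝓝 (NormedSpace.exp Z)) := by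
  have hev : ∀ᶠ n : ℕ in atTop, (n : ℝ) ≠ 0 := by
    filter_upwards [eventually_ge_atTop 1] with n hn
    positivity
  set v : ℕ → H →L[ℂ] H := fun n => NormedSpace.exp ((n : ℝ)⁻¹ • Z) with hvdef
  have hv : Tendsto (fun n : ℕ => (n : ℝ) • (v n - 1)) atTop (𝓝 Z) := by
    refine tendsto_smul_exp_sub_one Z tendsto_inv_atTop_nhds_zero_nat ?_ ?_
    · filter_upwards [hev] with n hn using inv_ne_zero hn
    · refine tendsto_const_nhds.congr' ?_
      filter_upwards [hev] with n hn using (mul_inv_cancel₀ hn).symm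
  have hvn : ∀ᶠ n : ℕ in atTop, v n ^ n = NormedSpace.exp Z := by
    filter_upwards [hev] with n hn
    have : NormedAlgebra ℚ (H →L[ℂ] H) := NormedAlgebra.restrictScalars ℚ ℝ _
    rw [hvdef, ← NormedSpace.exp_nsmul, ← Nat.cast_smul_eq_nsmul ℝ, smul_smul, mul_inv_cancel₀ hn,
      one_smul]
  have hd : Tendsto (fun n : ℕ => ‖(n : ℝ) • (w n - v n)‖) atTop (𝓝 0) := by
    have := (hw.sub hv).norm
    rw [sub_self, norm_zero] at this
    refine this.congr fun n => ?_
    rw [← smul_sub, sub_sub_sub_cancel_right]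
  -- Both norms are eventually at most `M = 1 + C / n`, and `M ^ n ≤ exp C`.
  set C : ℝ := ‖Z‖ + 1
  have hbound : ∀ {u : ℕ → H →L[ℂ] H}, Tendsto (fun n : ℕ => (n : ℝ) • (u n - 1)) atTop (𝓝 Z) →
      ∀ᶠ n : ℕ in atTop, ‖u n‖ ≤ 1 + C / n := by
    intro u hu
    filter_upwards [hu.norm.eventually_lt_const (lt_add_one ‖Z‖), eventually_ge_atTop 1]
      with n hn hn1
    have hnpos : (0 : ℝ) < n := by exact_mod_cast hn1
    rw [norm_smul, Real.norm_of_nonneg hnpos.le] at hn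
    have h1 : ‖u n - 1‖ ≤ C / n := by
      rw [le_div_iff₀ hnpos, mul_comm]
      exact hn.le
    calc ‖u n‖ = ‖1 + (u n - 1)‖ := by congr 1; abel
      _ ≤ ‖(1 : H →L[ℂ] H)‖ + ‖u n - 1‖ := norm_add_le _ _
      _ ≤ _ := add_le_add ContinuousLinearMap.norm_id_le h1
  rw [tendsto_iff_norm_sub_tendsto_zero]
  have hlim : Tendsto (fun n : ℕ => Real.exp C * ‖(n : ℝ) • (w n - v n)‖) atTop (𝓝 0) := by
    simpa using hd.const_mul (Real.exp C)
  refine tendsto_of_tendsto_of_tendsto_of_le_of_le' tendsto_const_nhds hlim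
    (Eventually.of_forall fun n => norm_nonneg _) ?_
  filter_upwards [hvn, hbound hw, hbound hv, eventually_ge_atTop 1] with n h1 h2 h3 h4
  have hnpos : (0 : ℝ) < n := by exact_mod_cast h4
  have hC : 0 ≤ C / n := by positivity
  rw [← h1, norm_smul, Real.norm_of_nonneg hnpos.le]
  refine (norm_pow_sub_pow_le (by linarith) h2 h3 n).trans ?_
  have h5 : (1 + C / n) ^ n ≤ Real.exp C := by
    calc (1 + C / n) ^ n ≤ Real.exp (C / n) ^ n := by
          gcongr
          rw [add_comm]
          exact Real.add_one_le_exp _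
      _ = Real.exp C := by rw [← Real.exp_nat_mul, mul_div_cancel₀ _ hnpos.ne']
  nlinarith [mul_le_mul_of_nonneg_right h5 (mul_nonneg hnpos.le (norm_nonneg (w n - v n)))]

theorem isIdempotent_starProjection (K : Submodule ℂ H) :
    K.starProjection * K.starProjection = K.starProjection := by
  ext v
  exact Submodule.starProjection_eq_self_iff.2 (Submodule.starProjection_apply_mem K v)

/-- The product `P * D * F` tends to `P` in the application, not to 1. Filling in the identity on
the complement gives a base near 1, to which `tendsto_pow_exp` applies; the two agree after
multiplication by `P` on the right. -/
theorem mul_pow_compressed {P D F : H →L[ℂ] H} (hP : P * P = P) (hPF : P * F = F) (hFP : F * P = F)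
    (n : ℕ) : (D * F) ^ (n + 1) = D * F * (1 - P + P * D * P * F) ^ n * P := by
  set w := 1 - P + P * D * P * F with hw
  have hwP : w * P = P * (D * F) := by
    rw [hw, add_mul, sub_mul, hP, one_mul, sub_self, zero_add, mul_assoc _ F, hFP, mul_assoc _ P F,
      hPF, mul_assoc]
  have h : ∀ n : ℕ, P * (D * F) ^ n = w ^ n * P := by
    intro n
    induction n with
    | zero => simp
    | succ n ih => rw [pow_succ, ← mul_assoc, ih, mul_assoc, ← hwP, ← mul_assoc, ← pow_succ]
  rw [pow_succ', mul_assoc (D * F), ← h, ← mul_assoc, mul_assoc D F P, hFP]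

theorem isLogProduct_expOn (K : Submodule ℂ H) {X Y : H →L[ℂ] H} (hX : IsSelfAdjoint X)
    (hY : IsSelfAdjoint Y) : IsLogProduct (expOn ⊤ X) (expOn K Y) (expOn K (X + Y)) := by
  set P := K.starProjection with hPdef
  have hP : P * P = P := isIdempotent_starProjection K
  -- The sequence is shifted by one, since peeling off a factor `D * F` leaves an `n`-th power out
  -- of an `(n + 1)`-st; only `n * t n → 1` is needed.
  set t : ℕ → ℝ := fun n => 1 / ((n : ℝ) + 1) with ht
  set D : ℕ → H →L[ℂ] H := fun n => NormedSpace.exp (t n • X) with hD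
  set E : ℕ → H →L[ℂ] H := fun n => NormedSpace.exp (t n • compress K Y) with hE
  have ht0 : Tendsto t atTop (𝓝 0) := tendsto_one_div_add_atTop_nhds_zero_nat
  have htne : ∀ n, t n ≠ 0 := fun n => by simp only [ht]; positivity
  have hnt : Tendsto (fun n : ℕ => n * t n) atTop (𝓝 1) := by
    have := ht0.const_sub 1
    rw [sub_zero] at this
    refine this.congr fun n => ?_
    simp only [ht]
    have : (n : ℝ) + 1 ≠ 0 := by positivity
    field_simp
    ring
  have hexp : ∀ Z : H →L[ℂ] H, Tendsto (fun n => NormedSpace.exp (t n • Z)) atTop (𝓝 1) := by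
    intro Z
    have h := (hasDerivAt_exp_smul_const (𝕂 := ℝ) Z 0).continuousAt.tendsto.comp ht0
    simpa [Function.comp_def] using h
  have hDlim := tendsto_smul_exp_sub_one X ht0 (Eventually.of_forall htne) hnt
  have hElim := tendsto_smul_exp_sub_one (compress K Y) ht0 (Eventually.of_forall htne) hnt
  have hFlim : Tendsto (fun n => P * E n * P) atTop (𝓝 P) := by
    have := ((hexp (compress K Y)).const_mul P).mul_const P
    rwa [mul_one, hP] at this
  have hcomp : ∀ Z : H →L[ℂ] H, P * compress K Z * P = compress K Z := fun Z =>
    compress_compress (le_refl K) Z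
  have hw : Tendsto (fun n : ℕ => (n : ℝ) • ((1 - P + P * D n * P * (P * E n * P)) - 1)) atTop
      (𝓝 (compress K (X + Y))) := by
    have h1 := (((hDlim.const_mul P).mul_const P).mul hFlim).add ((hElim.const_mul P).mul_const P)
    have h2 : P * X * P * P + P * compress K Y * P = compress K (X + Y) := by
      rw [hcomp, compress_add, mul_assoc _ P P, hP]; rfl
    rw [h2] at h1
    refine h1.congr fun n => ?_
    simp only [mul_smul_comm, smul_mul_assoc, ← smul_add]
    congr 1
    have h3 : P * (D n - 1) * P * (P * E n * P) + P * (E n - 1) * P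
        = P * D n * P * (P * E n * P) - (P * P) * (P * E n * P) + P * E n * P - P * P := by
      noncomm_ring
    have h4 : P * (P * E n * P) = P * E n * P := by rw [mul_assoc P, ← mul_assoc P P, hP]
    change P * (D n - 1) * P * (P * E n * P) + P * (E n - 1) * P = _
    rw [h3, hP, h4]
    abel
  have hlim := (((hexp X).mul hFlim).mul (tendsto_pow_exp hw)).mul_const P
  rw [one_mul] at hlim
  rw [IsLogProduct, ← tendsto_add_atTop_iff_nat 1]
  refine hlim.congr fun n => ?_
  have hn : (1 / ((n + 1 : ℕ) : ℝ)) = t n := by simp [ht]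
  have hF : expOn K (t n • Y) = P * E n * P := by rw [expOn, compress_smul]
  have hD' : expOn ⊤ (t n • X) = D n := by
    rw [expOn, compress_top, Submodule.starProjection_top]; rfl
  rw [hn, rpow_expOn ⊤ hX (htne n), rpow_expOn K hY (htne n), hF, hD']
  refine (mul_pow_compressed hP ?_ ?_ n).symm
  · rw [mul_assoc P, ← mul_assoc P P, hP]
  · rw [mul_assoc _ P P, hP]

/-! ### The mean in terms of supports and logarithms. -/

/-- The positive semidefinite operator with support `K` whose logarithm is the compression of `X`
to `K`. -/
def ofLog (K : Submodule ℂ H) (X : selfAdjoint (H →L[ℂ] H)) : PSD H :=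
  ⟨expOn K X.1, expOn_nonneg K X.2⟩

theorem supp_ofLog (K : Submodule ℂ H) (X : selfAdjoint (H →L[ℂ] H)) :
    supp (ofLog K X).1 = K := supp_expOn K X.2

theorem logHat_ofLog (K : Submodule ℂ H) (X : selfAdjoint (H →L[ℂ] H)) :
    logHat (ofLog K X).1 = compress K X.1 := logHat_expOn K X.2

theorem PSD.ext_log {A B : PSD H} (hs : supp A.1 = supp B.1) (hl : logHat A.1 = logHat B.1) :
    A = B := by
  ext1
  rw [← expOn_logHat A.2, hs, hl, expOn_logHat B.2]

/-- The extended logarithm as a self-adjoint operator. -/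
def saLog (A : H →L[ℂ] H) : selfAdjoint (H →L[ℂ] H) := ⟨logHat A, logHat_isSelfAdjoint A⟩

theorem mean_eq_ofLog (A B : PSD H) :
    mean A B = ofLog (supp A.1 ⊓ supp B.1) ((2⁻¹ : ℝ) • (saLog A.1 + saLog B.1)) := by
  ext1
  exact meanOp_eq_expOn A.1 B.1

theorem supp_mean (A B : PSD H) : supp (mean A B).1 = supp A.1 ⊓ supp B.1 := by
  rw [mean_eq_ofLog, supp_ofLog]

theorem logHat_mean (A B : PSD H) : logHat (mean A B).1 =
    compress (supp A.1 ⊓ supp B.1) ((2⁻¹ : ℝ) • (logHat A.1 + logHat B.1)) := by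
  rw [mean_eq_ofLog, logHat_ofLog]; rfl

theorem supp_le_iff_exists_mean {A B : PSD H} :
    supp A.1 ≤ supp B.1 ↔ ∃ C, mean B C = A := by
  refine ⟨fun h => ?_, ?_⟩
  -- The reflection of `log B` in `log A`, so that the midpoint is `log A`.
  · refine ⟨ofLog (supp A.1) ((2 : ℝ) • saLog A.1 - saLog B.1), ?_⟩
    have hs : supp B.1 ⊓ supp (ofLog (supp A.1) ((2 : ℝ) • saLog A.1 - saLog B.1)).1 = supp A.1 := by
      rw [supp_ofLog, inf_eq_right.2 h]
    refine PSD.ext_log (by rw [supp_mean, hs]) ?_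
    rw [logHat_mean, hs, logHat_ofLog, compress_smul, compress_add, compress_compress le_rfl,
      ← compress_add]
    have : logHat B.1 + ((2 : ℝ) • saLog A.1 - saLog B.1 : selfAdjoint (H →L[ℂ] H)).1
        = (2 : ℝ) • logHat A.1 := by
      change logHat B.1 + ((2 : ℝ) • logHat A.1 - logHat B.1) = _
      abel
    rw [this, compress_smul, smul_smul, compress_logHat A.2]
    norm_num
  · rintro ⟨C, rfl⟩
    rw [supp_mean]
    exact inf_le_left

theorem eq_zero_of_supp_eq_bot {A : PSD H} (h : supp A.1 = ⊥) : A = PSD.zero := by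
  ext1
  rw [← expOn_logHat A.2, h, expOn, Submodule.starProjection_bot]
  simp [PSD.zero]

theorem mean_ofLog_top {A : PSD H} {X : selfAdjoint (H →L[ℂ] H)}
    (h : compress (supp A.1) X.1 = logHat A.1) : mean A (ofLog ⊤ X) = A := by
  have hs : supp A.1 ⊓ supp (ofLog ⊤ X).1 = supp A.1 := by rw [supp_ofLog, inf_top_eq]
  refine PSD.ext_log (by rw [supp_mean, hs]) ?_
  rw [logHat_mean, hs, logHat_ofLog, compress_top, compress_smul, compress_add, h,
    compress_logHat A.2, ← two_smul ℝ, smul_smul]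
  norm_num

theorem mean_ofLog_top_ofLog_top (X Y : selfAdjoint (H →L[ℂ] H)) :
    mean (ofLog ⊤ X) (ofLog ⊤ Y) = ofLog ⊤ ((2⁻¹ : ℝ) • (X + Y)) := by
  have hs : supp (ofLog ⊤ X).1 ⊓ supp (ofLog ⊤ Y).1 = ⊤ := by
    rw [supp_ofLog, supp_ofLog, inf_top_eq]
  refine PSD.ext_log (by rw [supp_mean, hs, supp_ofLog]) ?_
  rw [logHat_mean, hs, logHat_ofLog, logHat_ofLog, logHat_ofLog, compress_top, compress_top,
    compress_top, compress_top]
  rfl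

theorem expOn_smul_one (K : Submodule ℂ H) (t : ℝ) :
    expOn K (t • (1 : H →L[ℂ] H)) = Real.exp t • K.starProjection := by
  have hX : IsSelfAdjoint (t • (1 : H →L[ℂ] H)) := IsSelfAdjoint.smul (IsSelfAdjoint.all t) (.one _)
  refine eigen_compress_ext hX (K := K) (fun v hv => ?_) fun v hv r _ => ?_
  · rw [expOn_apply_of_mem_orthogonal _ hv, smul_apply,
      (Submodule.starProjection_apply_eq_zero_iff K).2 hv, smul_zero]
  · have hP : K.starProjection v = v := Submodule.starProjection_eq_self_iff.2 hv
    rw [expOn_apply_of_eigen hX hv (r := t), smul_apply, hP, Complex.coe_smul]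
    simp [compress, hP]

theorem ofLog_top_zero : ofLog (⊤ : Submodule ℂ H) 0 = PSD.one := by
  ext1
  have h := expOn_smul_one (⊤ : Submodule ℂ H) 0
  rw [zero_smul, Real.exp_zero, one_smul, Submodule.starProjection_top] at h
  exact h

/-- If `h s ≤ 0` for some `s > 0`, then `h (-n s) = -n h s ≥ 0` for all `n`, against the limit. So
`h` is strictly increasing, and density of the rationals makes it linear. -/
theorem exists_eq_mul_of_tendsto_atBot {h : ℝ →+ ℝ} (hh : Tendsto h atBot atBot) :
    ∃ c : ℝ, 0 < c ∧ ∀ t, h t = c * t := by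
  have hpos : ∀ s, 0 < s → 0 < h s := by
    intro s hs
    by_contra hn
    push Not at hn
    have h1 : Tendsto (fun n : ℕ => -((n : ℝ) * s)) atTop atBot :=
      tendsto_neg_atTop_atBot.comp (tendsto_natCast_atTop_atTop.atTop_mul_const hs)
    obtain ⟨n, hn1⟩ := ((hh.comp h1).eventually_lt_atBot 0).exists
    have h2 : h (-((n : ℝ) * s)) = -(n * h s) := by
      rw [map_neg, ← nsmul_eq_mul, map_nsmul, nsmul_eq_mul]
    simp only [Function.comp_apply] at hn1
    rw [h2] at hn1
    have : (n : ℝ) * h s ≤ 0 := mul_nonpos_of_nonneg_of_nonpos (Nat.cast_nonneg n) hn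
    linarith
  have hmono : ∀ s t, s < t → h s < h t := by
    intro s t hst
    have := hpos (t - s) (sub_pos.2 hst)
    rw [map_sub] at this
    linarith
  have hrat : ∀ r : ℚ, h r = r * h 1 := by
    intro r
    have := map_rat_smul h r (1 : ℝ)
    rwa [Rat.smul_def, Rat.smul_def, mul_one] at this
  have hc := hpos 1 one_pos
  refine ⟨h 1, hc, fun t => ?_⟩
  rcases lt_trichotomy (h t) (h 1 * t) with hlt | heq | hgt
  · obtain ⟨r, hr1, hr2⟩ := exists_rat_btwn ((div_lt_iff₀' hc).2 hlt)
    have h1 := hmono _ _ hr2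
    rw [hrat] at h1
    rw [div_lt_iff₀ hc] at hr1
    linarith
  · exact heq
  · obtain ⟨r, hr1, hr2⟩ := exists_rat_btwn ((lt_div_iff₀' hc).2 hgt)
    have h1 := hmono _ _ hr1
    rw [hrat] at h1
    rw [lt_div_iff₀ hc] at hr2
    linarith

/-! ### The action of φ on supports and logarithms. -/

section Map

variable {φ : PSD H → PSD H} (hbij : Function.Bijective φ)
  (hmean : ∀ A B : PSD H, φ (mean A B) = mean (φ A) (φ B))

include hbij hmean

theorem supp_map_le_iff {A B : PSD H} :
    supp (φ A).1 ≤ supp (φ B).1 ↔ supp A.1 ≤ supp B.1 := by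
  rw [supp_le_iff_exists_mean, supp_le_iff_exists_mean]
  constructor
  · rintro ⟨C, hC⟩
    obtain ⟨C, rfl⟩ := hbij.2 C
    exact ⟨C, hbij.1 (by rw [hmean, hC])⟩
  · rintro ⟨C, rfl⟩
    exact ⟨φ C, (hmean _ _).symm⟩

theorem supp_map_eq_top_iff {A : PSD H} : supp (φ A).1 = ⊤ ↔ supp A.1 = ⊤ := by
  constructor
  · intro h
    rw [eq_top_iff, ← supp_ofLog ⊤ 0, ← supp_map_le_iff hbij hmean, h]
    exact le_top
  · intro h
    obtain ⟨B, hB⟩ := hbij.2 (ofLog ⊤ 0)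
    rw [eq_top_iff, ← supp_ofLog ⊤ 0, ← hB, supp_map_le_iff hbij hmean, h]
    exact le_top

theorem supp_map_eq_bot_iff {A : PSD H} : supp (φ A).1 = ⊥ ↔ supp A.1 = ⊥ := by
  constructor
  · intro h
    rw [eq_bot_iff, ← supp_ofLog ⊥ 0, ← supp_map_le_iff hbij hmean, h]
    exact bot_le
  · intro h
    obtain ⟨B, hB⟩ := hbij.2 (ofLog ⊥ 0)
    rw [eq_bot_iff, ← supp_ofLog ⊥ 0, ← hB, supp_map_le_iff hbij hmean, h]
    exact bot_le

theorem map_zero_eq_zero : φ PSD.zero = PSD.zero := by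
  refine eq_zero_of_supp_eq_bot ((supp_map_eq_bot_iff hbij hmean).2 ?_)
  have : ofLog (⊥ : Submodule ℂ H) 0 = PSD.zero := eq_zero_of_supp_eq_bot (supp_ofLog _ _)
  rw [← this, supp_ofLog]

/-- Apply φ to the absorption identity `mean_ofLog_top` and compare logarithms. This reduces φ to
its values on invertible operators. -/
theorem logHat_map_eq_compress {A : PSD H} {X : selfAdjoint (H →L[ℂ] H)}
    (h : compress (supp A.1) X.1 = logHat A.1) :
    logHat (φ A).1 = compress (supp (φ A).1) (logHat (φ (ofLog ⊤ X)).1) := by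
  have hs : supp (φ (ofLog ⊤ X)).1 = ⊤ := (supp_map_eq_top_iff hbij hmean).2 (supp_ofLog _ _)
  have h1 := congrArg φ (mean_ofLog_top h)
  rw [hmean] at h1
  have h2 : logHat (mean (φ A) (φ (ofLog ⊤ X))).1 = logHat (φ A).1 := by rw [h1]
  rw [logHat_mean, hs, inf_top_eq, compress_smul, compress_add, compress_logHat (φ A).2] at h2
  have h3 : logHat (φ A).1 = (2⁻¹ : ℝ) • (logHat (φ A).1 + logHat (φ A).1) := by
    rw [← two_smul ℝ, smul_smul]; norm_num
  have h4 := h2.trans h3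
  exact (add_left_cancel (smul_right_injective _ (by norm_num : (2⁻¹ : ℝ) ≠ 0) h4)).symm

theorem logHat_map_midpoint (X Y : selfAdjoint (H →L[ℂ] H)) :
    logHat (φ (ofLog ⊤ ((2⁻¹ : ℝ) • (X + Y)))).1 =
      (2⁻¹ : ℝ) • (logHat (φ (ofLog ⊤ X)).1 + logHat (φ (ofLog ⊤ Y)).1) := by
  have hs : ∀ X, supp (φ (ofLog ⊤ X)).1 = ⊤ := fun X =>
    (supp_map_eq_top_iff hbij hmean).2 (supp_ofLog _ _)
  rw [← mean_ofLog_top_ofLog_top, hmean, logHat_mean, hs, hs, inf_top_eq, compress_top]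

/-- Take `x` in the support of a preimage of the projection onto `ℂ y`. An operator supported on `ℂ
x` has an image with nonzero support inside `ℂ y`, hence equal to it. -/
theorem exists_unit_mem_supp_iff {y : H} (hy : y ≠ 0) : ∃ x : H, ‖x‖ = 1 ∧
    (∀ A : PSD H, y ∈ supp (φ A).1 ↔ x ∈ supp A.1) ∧
    ∀ A : PSD H, supp A.1 = ℂ ∙ x → supp (φ A).1 = ℂ ∙ y := by
  obtain ⟨A₀, hA₀⟩ := hbij.2 (ofLog (ℂ ∙ y) 0)
  have hs : supp (φ A₀).1 = ℂ ∙ y := by rw [hA₀, supp_ofLog]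
  have hne : supp A₀.1 ≠ ⊥ := by
    rw [Ne, ← supp_map_eq_bot_iff hbij hmean, hs, Submodule.span_singleton_eq_bot]
    exact hy
  obtain ⟨x₀, hx₀, hx₀ne⟩ := Submodule.exists_mem_ne_zero_of_ne_bot hne
  set x : H := ((‖x₀‖⁻¹ : ℝ) : ℂ) • x₀ with hx
  have hx1 : ‖x‖ = 1 := by
    rw [hx, norm_smul, Complex.norm_real, norm_inv, norm_norm,
      inv_mul_cancel₀ (norm_ne_zero_iff.2 hx₀ne)]
  have hxne : x ≠ 0 := by rw [← norm_ne_zero_iff, hx1]; exact one_ne_zero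
  have hxA : x ∈ supp A₀.1 := Submodule.smul_mem _ _ hx₀
  have hspan : ∀ A : PSD H, supp A.1 = ℂ ∙ x → supp (φ A).1 = ℂ ∙ y := by
    intro A hA
    have hle : supp (φ A).1 ≤ ℂ ∙ y := by
      rw [← hs, supp_map_le_iff hbij hmean, hA, Submodule.span_singleton_le_iff_mem]
      exact hxA
    have hne' : supp (φ A).1 ≠ ⊥ := by
      rw [Ne, supp_map_eq_bot_iff hbij hmean, hA, Submodule.span_singleton_eq_bot]
      exact hxne
    obtain ⟨w, hw, hwne⟩ := Submodule.exists_mem_ne_zero_of_ne_bot hne'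
    refine le_antisymm hle ?_
    obtain ⟨c, rfl⟩ := Submodule.mem_span_singleton.1 (hle hw)
    have hc : c ≠ 0 := fun h => hwne (by rw [h, zero_smul])
    rw [Submodule.span_singleton_le_iff_mem]
    simpa [smul_smul, inv_mul_cancel₀ hc] using Submodule.smul_mem _ c⁻¹ hw
  refine ⟨x, hx1, fun A => ?_, hspan⟩
  rw [← Submodule.span_singleton_le_iff_mem, ← Submodule.span_singleton_le_iff_mem,
    ← hspan (ofLog (ℂ ∙ x) 0) (supp_ofLog _ _), supp_map_le_iff hbij hmean, supp_ofLog]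

end Map

/-! ### Diagonal values of the induced map on logarithms. -/

theorem coe_re_inner_apply_self {Z : H →L[ℂ] H} (hZ : IsSelfAdjoint Z) (v : H) :
    (((⟪v, Z v⟫_ℂ).re : ℝ) : ℂ) = ⟪v, Z v⟫_ℂ :=
  hZ.isSymmetric.coe_re_inner_self_apply v

theorem compress_span_unit {x : H} (hx : ‖x‖ = 1) (Z : H →L[ℂ] H) (v : H) :
    compress (ℂ ∙ x) Z v = (⟪x, v⟫_ℂ * ⟪x, Z x⟫_ℂ) • x := by
  simp only [compress, mul_apply_eq_comp]
  rw [Submodule.starProjection_unit_singleton ℂ hx, Submodule.starProjection_unit_singleton ℂ hx,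
    map_smul, inner_smul_right]

theorem compress_span_apply_self {y : H} (hy : y ≠ 0) {Z : H →L[ℂ] H} (hZ : IsSelfAdjoint Z) :
    compress (ℂ ∙ y) Z y = (((⟪y, Z y⟫_ℂ).re / ‖y‖ ^ 2 : ℝ) : ℂ) • y := by
  obtain ⟨c, hc⟩ := Submodule.mem_span_singleton.1 (compress_apply_mem (ℂ ∙ y) Z y)
  have h := inner_compress_apply_self Z (Submodule.mem_span_singleton_self (R := ℂ) y)
  rw [← hc, inner_smul_right, inner_self_eq_norm_sq_to_K] at h
  have hy' : ((‖y‖ : ℂ)) ^ 2 ≠ 0 := by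
    rw [← Complex.ofReal_pow]
    exact Complex.ofReal_ne_zero.2 (by positivity)
  rw [← hc, Complex.ofReal_div, coe_re_inner_apply_self hZ, ← h]
  congr 1
  rw [Complex.ofReal_pow]
  exact (mul_div_cancel_right₀ c hy').symm

section Map

variable {φ : PSD H → PSD H} (hbij : Function.Bijective φ)
  (hmean : ∀ A B : PSD H, φ (mean A B) = mean (φ A) (φ B)) (hcont : ContinuousAt φ PSD.zero)

include hbij hmean hcont

/-- As `t → -∞`, `exp t` times the projection onto `ℂ x` tends to 0, hence so does its image under
φ, for which `y` is an eigenvector with eigenvalue `exp (k t / ‖y‖ ^ 2)`. -/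
theorem tendsto_re_inner_logHat_map {x y : H} (hy : y ≠ 0)
    (hspan : ∀ A : PSD H, supp A.1 = ℂ ∙ x → supp (φ A).1 = ℂ ∙ y) :
    Tendsto (fun t : ℝ => (⟪y, logHat (φ (ofLog ⊤ (t • 1))).1 y⟫_ℂ).re) atBot atBot := by
  set k : ℝ → ℝ := fun t => (⟪y, logHat (φ (ofLog ⊤ (t • 1))).1 y⟫_ℂ).re with hk
  have hzero : Tendsto (fun t : ℝ => ofLog (ℂ ∙ x) (t • 1)) atBot (𝓝 PSD.zero) := by
    rw [tendsto_subtype_rng]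
    have h1 : Tendsto (fun t : ℝ => Real.exp t • (ℂ ∙ x).starProjection) atBot (𝓝 0) := by
      simpa using Real.tendsto_exp_atBot.smul_const (ℂ ∙ x).starProjection
    exact h1.congr fun t => (expOn_smul_one _ t).symm
  have h2 := hcont.tendsto.comp hzero
  rw [map_zero_eq_zero hbij hmean, tendsto_subtype_rng] at h2
  have h3 : Tendsto (fun t : ℝ => (φ (ofLog (ℂ ∙ x) (t • 1))).1 y) atBot (𝓝 0) :=
    ((ContinuousLinearMap.apply ℂ H y).continuous.tendsto _).comp h2
  have h4 : ∀ t : ℝ, (φ (ofLog (ℂ ∙ x) (t • 1))).1 y = (Real.exp (k t / ‖y‖ ^ 2) : ℂ) • y := by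
    intro t
    set A : PSD H := ofLog (ℂ ∙ x) (t • 1) with hA
    have hs : supp (φ A).1 = ℂ ∙ y := hspan A (supp_ofLog _ _)
    have hl : logHat (φ A).1 = compress (ℂ ∙ y) (logHat (φ (ofLog ⊤ (t • 1))).1) := by
      rw [← hs]
      refine logHat_map_eq_compress hbij hmean ?_
      rw [hA, logHat_ofLog, supp_ofLog]
    conv_lhs => rw [← expOn_logHat (φ A).2]
    rw [hs, expOn_apply_of_eigen (logHat_isSelfAdjoint _) (Submodule.mem_span_singleton_self y)]
    rw [hl, compress_compress le_rfl, compress_span_apply_self hy (logHat_isSelfAdjoint _)]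
  have h5 : Tendsto (fun t => Real.exp (k t / ‖y‖ ^ 2)) atBot (𝓝 0) := by
    have h6 := h3.norm.div_const ‖y‖
    rw [norm_zero, zero_div] at h6
    refine h6.congr fun t => ?_
    rw [h4, norm_smul, mul_div_cancel_right₀ _ (norm_ne_zero_iff.2 hy), Complex.norm_real,
      Real.norm_of_nonneg (Real.exp_pos _).le]
  have h7 := Real.tendsto_exp_comp_nhds_zero.1 h5
  have hpos : 0 < ‖y‖ ^ 2 := by positivity
  exact (h7.atBot_mul_const hpos).congr fun t => div_mul_cancel₀ _ hpos.ne'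

theorem exists_inner_logHat_map {y : H} (hy : y ≠ 0) : ∃ s : H,
    (∀ A : PSD H, y ∈ supp (φ A).1 ↔ s ∈ supp A.1) ∧
    ∀ X : selfAdjoint (H →L[ℂ] H),
      ⟪y, (logHat (φ (ofLog ⊤ X)).1 - logHat (φ PSD.one).1) y⟫_ℂ = ⟪s, X.1 s⟫_ℂ := by
  obtain ⟨x, hx, hiff, hspan⟩ := exists_unit_mem_supp_iff hbij hmean hy
  set k : ℝ → ℝ := fun t => (⟪y, logHat (φ (ofLog ⊤ (t • 1))).1 y⟫_ℂ).re with hk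
  have hkbot : Tendsto k atBot atBot := tendsto_re_inner_logHat_map hbij hmean hcont hy hspan
  have hmid : ∀ s t, k (2⁻¹ * (s + t)) = 2⁻¹ * (k s + k t) := by
    intro s t
    simp only [hk]
    have h1 : (2⁻¹ * (s + t)) • (1 : selfAdjoint (H →L[ℂ] H)) = (2⁻¹ : ℝ) • (s • 1 + t • 1) := by
      ext1
      change (2⁻¹ * (s + t)) • (1 : H →L[ℂ] H) = (2⁻¹ : ℝ) • (s • 1 + t • 1)
      rw [mul_smul, add_smul]
    rw [h1, logHat_map_midpoint hbij hmean, smul_apply, add_apply,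
      ← Complex.coe_smul, inner_smul_right, Complex.re_ofReal_mul, inner_add_right, Complex.add_re]
  -- Additivity comes from the midpoint equation at `(2s, 2t)`, `(2s, 0)` and `(2t, 0)`.
  let h : ℝ →+ ℝ := AddMonoidHom.mk' (fun t => k t - k 0) fun s t => by
    have h1 := hmid (2 * s) (2 * t)
    have h2 := hmid (2 * s) 0
    have h3 := hmid (2 * t) 0
    rw [← mul_add, inv_mul_cancel_left₀ two_ne_zero] at h1
    rw [add_zero, inv_mul_cancel_left₀ two_ne_zero] at h2 h3
    linarith
  obtain ⟨c, hc, hlin⟩ := exists_eq_mul_of_tendsto_atBot (h := h)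
    (tendsto_atBot_add_const_right _ (-k 0) hkbot)
  have hlin : ∀ t, k t - k 0 = c * t := hlin
  have hX : ∀ X : selfAdjoint (H →L[ℂ] H),
      ⟪y, logHat (φ (ofLog ⊤ X)).1 y⟫_ℂ = k (⟪x, X.1 x⟫_ℂ).re := by
    intro X
    set t := (⟪x, X.1 x⟫_ℂ).re
    -- On the line `ℂ x` only the number `t` is visible, so `X` and `t • 1` extend the same
    -- operator.
    have hcomp : compress (ℂ ∙ x) X.1 = compress (ℂ ∙ x) (t • (1 : H →L[ℂ] H)) := by
      ext v
      rw [compress_span_unit hx, compress_span_unit hx]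
      congr 2
      rw [← coe_re_inner_apply_self X.2, smul_apply, one_apply_eq_self, ← Complex.coe_smul,
        inner_smul_right, inner_self_eq_norm_sq_to_K, hx]
      simp [t]
    have hmem : y ∈ supp (φ (ofLog (ℂ ∙ x) X)).1 := by
      rw [hiff, supp_ofLog]
      exact Submodule.mem_span_singleton_self x
    have h1 : logHat (φ (ofLog (ℂ ∙ x) X)).1 =
        compress (supp (φ (ofLog (ℂ ∙ x) X)).1) (logHat (φ (ofLog ⊤ X)).1) :=
      logHat_map_eq_compress hbij hmean (by rw [logHat_ofLog, supp_ofLog])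
    have h2 : logHat (φ (ofLog (ℂ ∙ x) X)).1 =
        compress (supp (φ (ofLog (ℂ ∙ x) X)).1) (logHat (φ (ofLog ⊤ (t • 1))).1) :=
      logHat_map_eq_compress hbij hmean (by rw [logHat_ofLog, supp_ofLog, hcomp]; rfl)
    rw [← inner_compress_apply_self _ hmem, ← h1, h2, inner_compress_apply_self _ hmem]
    exact (coe_re_inner_apply_self (logHat_isSelfAdjoint _) y).symm
  have hx0 : ((Real.sqrt c : ℝ) : ℂ) ≠ 0 := Complex.ofReal_ne_zero.2 (Real.sqrt_pos.2 hc).ne'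
  -- The positive slope `c` is absorbed into the vector, where it enters quadratically.
  refine ⟨(Real.sqrt c : ℂ) • x, fun A => ?_, fun X => ?_⟩
  · rw [hiff, Submodule.smul_mem_iff _ hx0]
  · have h0 : ⟪y, logHat (φ PSD.one).1 y⟫_ℂ = k 0 := by
      rw [← ofLog_top_zero, hX 0]
      simp
    rw [sub_apply, inner_sub_right, h0, hX, ← Complex.ofReal_sub, hlin, Complex.ofReal_mul,
      coe_re_inner_apply_self X.2, map_smul, inner_smul_left, inner_smul_right,
      Complex.conj_ofReal, ← mul_assoc, ← Complex.ofReal_mul, Real.mul_self_sqrt hc.le]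

end Map

/-! ### Sesquilinear functionals tested on self-adjoint operators. -/

theorem forall_of_forall_selfAdjoint {L : (H →L[ℂ] H) →ₗ[ℂ] ℂ}
    (h : ∀ X : selfAdjoint (H →L[ℂ] H), L X.1 = 0) (Z : H →L[ℂ] H) : L Z = 0 := by
  rw [← realPart_add_I_smul_imaginaryPart Z, map_add, map_smul, h, h, smul_zero, add_zero]

/-- The functional `Z ↦ ⟪u, Z v⟫`. -/
def sesqFunctional (u v : H) : (H →L[ℂ] H) →ₗ[ℂ] ℂ :=
  (innerₛₗ ℂ u) ∘ₗ (ContinuousLinearMap.apply ℂ H v : (H →L[ℂ] H) →ₗ[ℂ] H)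

theorem sesqFunctional_apply (u v : H) (Z : H →L[ℂ] H) : sesqFunctional u v Z = ⟪u, Z v⟫_ℂ := rfl

theorem sesqFunctional_rankOne (u v f g : H) :
    sesqFunctional u v (InnerProductSpace.rankOne ℂ f g) = ⟪g, v⟫_ℂ * ⟪u, f⟫_ℂ := by
  rw [sesqFunctional_apply, InnerProductSpace.rankOne_apply, inner_smul_right]

theorem exists_dual_vector {a b : H} (h : a ∉ ℂ ∙ b) : ∃ f : H, ⟪a, f⟫_ℂ = 1 ∧ ⟪b, f⟫_ℂ = 0 := by
  have : ∃ w ∈ (ℂ ∙ b)ᗮ, ⟪a, w⟫_ℂ ≠ 0 := by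
    by_contra! hn
    apply h
    rw [← Submodule.orthogonal_orthogonal (ℂ ∙ b), Submodule.mem_orthogonal']
    exact hn
  obtain ⟨w, hw, hne⟩ := this
  refine ⟨(⟪a, w⟫_ℂ)⁻¹ • w, ?_, ?_⟩
  · rw [inner_smul_right, inv_mul_cancel₀ hne]
  · rw [inner_smul_right, Submodule.mem_orthogonal_singleton_iff_inner_right.1 hw, mul_zero]

theorem inner_dual_symm {a f : H} {c : ℝ} (h : ⟪a, f⟫_ℂ = c) : ⟪f, a⟫_ℂ = c := by
  rw [← inner_conj_symm, h, Complex.conj_ofReal]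

/-- Vanishing on self-adjoint operators extends to all operators; the rank-one operators built from
vectors dual to `a` and `b` then isolate each coefficient. -/
theorem sesqFunctional_independent {a b : H} (hab : a ∉ ℂ ∙ b) (hba : b ∉ ℂ ∙ a)
    {c₁ c₂ c₃ c₄ : ℂ} (h : ∀ X : selfAdjoint (H →L[ℂ] H),
      c₁ * ⟪a, X.1 a⟫_ℂ + c₂ * ⟪b, X.1 b⟫_ℂ + c₃ * ⟪a, X.1 b⟫_ℂ + c₄ * ⟪b, X.1 a⟫_ℂ = 0) :
    c₁ = 0 ∧ c₂ = 0 ∧ c₃ = 0 ∧ c₄ = 0 := by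
  set L := c₁ • sesqFunctional a a + c₂ • sesqFunctional b b + c₃ • sesqFunctional a b +
    c₄ • sesqFunctional b a with hL
  have h0 := forall_of_forall_selfAdjoint (L := L) h
  obtain ⟨f, haf, hbf⟩ := exists_dual_vector hab
  obtain ⟨g, hbg, hag⟩ := exists_dual_vector hba
  have hfa : ⟪f, a⟫_ℂ = 1 := by simpa using inner_dual_symm (c := 1) (by simpa using haf)
  have hfb : ⟪f, b⟫_ℂ = 0 := by simpa using inner_dual_symm (c := 0) (by simpa using hbf)
  have hgb : ⟪g, b⟫_ℂ = 1 := by simpa using inner_dual_symm (c := 1) (by simpa using hbg)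
  have hga : ⟪g, a⟫_ℂ = 0 := by simpa using inner_dual_symm (c := 0) (by simpa using hag)
  have h1 := h0 (InnerProductSpace.rankOne ℂ f f)
  have h2 := h0 (InnerProductSpace.rankOne ℂ g g)
  have h3 := h0 (InnerProductSpace.rankOne ℂ f g)
  have h4 := h0 (InnerProductSpace.rankOne ℂ g f)
  simp only [hL, LinearMap.add_apply, LinearMap.smul_apply, sesqFunctional_rankOne, haf, hbf, hbg,
    hag, hfa, hfb, hgb, hga, smul_eq_mul, mul_zero, mul_one, add_zero, zero_add] at h1 h2 h3 h4
  exact ⟨h1, h2, h3, h4⟩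

open ComplexConjugate in
-- The hypothesis is `|α|² |β|² = (conj β * α) * (conj α * β)` with each factor expanded in `s`. The
-- right side is homogeneous of degree 2 under real scaling, so `s = p, -p, 2p` force `p = 0` and
-- then `s = r, -r` force `r = 0`. What remains is `|s|² = |conj s * m + s * conj n|²`, which gives
-- `m * n = 0` and `|m|² + |n|² = 1`.
theorem coefficients_of_rank_one {p r m n : ℂ} (h : ∀ s : ℂ,
    (1 + conj s * r + s * conj r) * (s * conj s + conj s * p + s * conj p) =
      (conj s * m + s * conj n) * (s * conj m + conj s * n)) :
    p = 0 ∧ r = 0 ∧ (n = 0 ∧ ‖m‖ = 1 ∨ m = 0 ∧ ‖n‖ = 1) := by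
  have hp : p = 0 := by
    have h1 := h p
    have h2 := h (-p)
    have h3 := h (2 * p)
    simp only [map_neg, map_mul, Complex.conj_ofNat] at h1 h2 h3
    have : p * conj p = 0 := by linear_combination (1 / 2) * h1 - (1 / 6) * h2 - (1 / 12) * h3
    simpa using this
  subst hp
  have hr : r = 0 := by
    have h1 := h r
    have h2 := h (-r)
    simp only [map_neg, map_zero] at h1 h2
    have : (r * conj r) * (r * conj r) = 0 := by linear_combination (1 / 4) * h1 - (1 / 4) * h2
    simpa using this
  subst hr
  have h1 := h 1
  have h2 := h Complex.I
  have h3 := h (1 + Complex.I)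
  simp only [map_one, map_zero, map_add, Complex.conj_I] at h1 h2 h3
  have hI := Complex.I_sq
  have e1 : m * conj m + m * n + conj m * conj n + n * conj n = 1 := by linear_combination -h1
  have e2 : m * conj m - m * n - conj m * conj n + n * conj n = 1 := by
    linear_combination -h2 + (m * conj m - m * n - conj m * conj n + n * conj n - 1) * hI
  have e3 : 2 * Complex.I * (conj m * conj n - m * n) + 2 * (m * conj m + n * conj n) = 2 := by
    linear_combination -h3 + (m * conj m - m * n - conj m * conj n + n * conj n - 1) * hI
  have hmn : m * n = 0 := by
    linear_combination (1 / 4) * (e1 - e2) + (Complex.I / 4) * (e3 - e1 - e2) -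
      (1 / 2) * (conj m * conj n - m * n) * hI
  have hn : m * conj m + n * conj n = 1 := by linear_combination (1 / 2) * (e1 + e2)
  refine ⟨rfl, rfl, ?_⟩
  rcases mul_eq_zero.1 hmn with hm | hn0
  · right
    rw [hm, zero_mul, zero_add, Complex.mul_conj'] at hn
    refine ⟨hm, ?_⟩
    have : ‖n‖ ^ 2 = 1 := by exact_mod_cast hn
    exact (pow_eq_one_iff_of_nonneg (norm_nonneg n) two_ne_zero).1 this
  · left
    rw [hn0, zero_mul, add_zero, Complex.mul_conj'] at hn
    refine ⟨hn0, ?_⟩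
    have : ‖m‖ ^ 2 = 1 := by exact_mod_cast hn
    exact (pow_eq_one_iff_of_nonneg (norm_nonneg m) two_ne_zero).1 this

/-- Detects membership in a subspace by a quadratic form, the only data available about the vectors
`S y`. -/
theorem inner_starProjection_self_eq_zero_iff (K : Submodule ℂ H) (v : H) :
    ⟪v, Kᗮ.starProjection v⟫_ℂ = 0 ↔ v ∈ K := by
  have h : ⟪v, Kᗮ.starProjection v⟫_ℂ = ⟪Kᗮ.starProjection v, Kᗮ.starProjection v⟫_ℂ := by
    rw [Submodule.inner_starProjection_left_eq_right]
    congr 1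
    exact (Submodule.starProjection_eq_self_iff.2 (Submodule.starProjection_apply_mem Kᗮ v)).symm
  rw [h, inner_self_eq_zero, Submodule.starProjection_apply_eq_zero_iff,
    Submodule.orthogonal_orthogonal]

/-- The orthogonal projection onto the orthogonal complement, as a self-adjoint operator. -/
def saProj (K : Submodule ℂ H) : selfAdjoint (H →L[ℂ] H) :=
  ⟨Kᗮ.starProjection, isSelfAdjoint_starProjection _⟩

theorem exists_smul_eq_of_forall_inner_eq {u v : H} (hv : v ≠ 0)
    (h : ∀ X : selfAdjoint (H →L[ℂ] H), ⟪u, X.1 u⟫_ℂ = ⟪v, X.1 v⟫_ℂ) :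
    ∃ z : ℂ, z ≠ 0 ∧ u = z • v := by
  have h1 : ⟪u, (ℂ ∙ v)ᗮ.starProjection u⟫_ℂ = 0 := by
    refine (h (saProj (ℂ ∙ v))).trans ?_
    exact (inner_starProjection_self_eq_zero_iff _ v).2 (Submodule.mem_span_singleton_self v)
  obtain ⟨z, rfl⟩ := Submodule.mem_span_singleton.1 ((inner_starProjection_self_eq_zero_iff _ u).1 h1)
  refine ⟨z, ?_, rfl⟩
  rintro rfl
  have h2 := h 1
  simp only [zero_smul, inner_zero_left] at h2
  exact hv (inner_self_eq_zero.1 h2.symm)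

/-! ### From vectorwise forms to a linear or conjugate-linear congruence. -/

section Congruence

variable {G : selfAdjoint (H →L[ℂ] H) → selfAdjoint (H →L[ℂ] H)} {S : H → H}
  (hG : Function.Surjective G)
  (hS : ∀ (y : H) (X : selfAdjoint (H →L[ℂ] H)), ⟪y, (G X).1 y⟫_ℂ = ⟪S y, X.1 (S y)⟫_ℂ)

include hG hS

theorem root_ne_zero {y : H} (hy : y ≠ 0) : S y ≠ 0 := by
  intro h
  obtain ⟨X, hX⟩ := hG 1
  have h1 := hS y X
  rw [h, inner_zero_left, hX] at h1
  exact hy (inner_self_eq_zero.1 h1)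

theorem root_notMem_span {x e : H} (hx : x ∉ ℂ ∙ e) : S x ∉ ℂ ∙ S e := by
  intro h
  obtain ⟨c, hc⟩ := Submodule.mem_span_singleton.1 h
  obtain ⟨X, hX⟩ := hG (saProj (ℂ ∙ e))
  have he : ⟪e, (G X).1 e⟫_ℂ = 0 := by
    rw [hX]
    exact (inner_starProjection_self_eq_zero_iff _ e).2 (Submodule.mem_span_singleton_self e)
  have h1 := hS x X
  rw [← hc, map_smul, inner_smul_left, inner_smul_right, ← hS, he, mul_zero, mul_zero, hX] at h1
  exact hx ((inner_starProjection_self_eq_zero_iff _ x).1 h1)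

omit hG

theorem inner_root_add (x e : H) (s : ℂ) (X : selfAdjoint (H →L[ℂ] H)) :
    ⟪S (x + s • e), X.1 (S (x + s • e))⟫_ℂ = ⟪S x, X.1 (S x)⟫_ℂ +
      s * (starRingEnd ℂ) s * ⟪S e, X.1 (S e)⟫_ℂ + (starRingEnd ℂ) s * ⟪e, (G X).1 x⟫_ℂ +
      s * (starRingEnd ℂ) ⟪e, (G X).1 x⟫_ℂ := by
  have hsymm : ⟪x, (G X).1 e⟫_ℂ = (starRingEnd ℂ) ⟪e, (G X).1 x⟫_ℂ := by
    rw [inner_conj_symm]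
    exact ((G X).2.isSymmetric x e).symm
  rw [← hS, ← hS, ← hS, map_add, map_smul, inner_add_left, inner_add_right, inner_add_right,
    inner_smul_left, inner_smul_left, inner_smul_right, inner_smul_right, hsymm]
  ring

open scoped ComplexOrder in
-- Test with the projection onto the complement of the span. Adding the expansions for `s` and `-s`
-- cancels the cross terms, so two nonnegative numbers sum to 0.
theorem root_add_mem_span (x e : H) (s : ℂ) :
    ∃ α β : ℂ, S (x + s • e) = α • S x + β • S e := by
  set K : Submodule ℂ H := Submodule.span ℂ {S x, S e}
  have hx : ⟪S x, (saProj K).1 (S x)⟫_ℂ = 0 :=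
    (inner_starProjection_self_eq_zero_iff K _).2 (Submodule.subset_span (by simp))
  have he : ⟪S e, (saProj K).1 (S e)⟫_ℂ = 0 :=
    (inner_starProjection_self_eq_zero_iff K _).2 (Submodule.subset_span (by simp))
  have h1 := inner_root_add hS x e s (saProj K)
  have h2 := inner_root_add hS x e (-s) (saProj K)
  have hsum : ⟪S (x + s • e), (saProj K).1 (S (x + s • e))⟫_ℂ +
      ⟪S (x + -s • e), (saProj K).1 (S (x + -s • e))⟫_ℂ = 0 := by
    rw [h1, h2, hx, he, map_neg]
    ring
  have hnn : ∀ v : H, 0 ≤ ⟪v, (saProj K).1 v⟫_ℂ := fun v =>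
    ((ContinuousLinearMap.nonneg_iff_isPositive _).1
      (isStarProjection_starProjection (U := Kᗮ)).nonneg).inner_nonneg_right v
  have h3 := ((add_eq_zero_iff_of_nonneg (hnn _) (hnn _)).1 hsum).1
  obtain ⟨α, β, h⟩ := Submodule.mem_span_pair.1 ((inner_starProjection_self_eq_zero_iff K _).1 h3)
  exact ⟨α, β, h.symm⟩

include hG

/-- A priori the off-diagonal form combines four functionals in `S e` and `S x`. That each `S (x + s
• e)` is a single vector makes its coefficient matrix rank one, leaving only one cross term, with a
unimodular factor. -/
theorem polar_form_eq {x e : H} (he : e ≠ 0) (hx : x ∉ ℂ ∙ e) :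
    (∃ m : ℂ, ‖m‖ = 1 ∧ ∀ X : selfAdjoint (H →L[ℂ] H), ⟪e, (G X).1 x⟫_ℂ = m * ⟪S e, X.1 (S x)⟫_ℂ) ∨
    ∃ n : ℂ, ‖n‖ = 1 ∧ ∀ X : selfAdjoint (H →L[ℂ] H),
      ⟪e, (G X).1 x⟫_ℂ = n * ⟪S x, X.1 (S e)⟫_ℂ := by
  have hex : e ∉ ℂ ∙ x := by
    intro h
    obtain ⟨c, rfl⟩ := Submodule.mem_span_singleton.1 h
    have hc : c ≠ 0 := by rintro rfl; simp at he
    exact hx (Submodule.mem_span_singleton.2 ⟨c⁻¹, by rw [smul_smul, inv_mul_cancel₀ hc, one_smul]⟩)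
  have hba := root_notMem_span hG hS hx
  have hab := root_notMem_span hG hS hex
  choose α β hαβ using root_add_mem_span hS x e
  set a := S e
  set b := S x
  have hexp : ∀ (s : ℂ) (X : selfAdjoint (H →L[ℂ] H)), ⟪S (x + s • e), X.1 (S (x + s • e))⟫_ℂ =
      (starRingEnd ℂ) (α s) * α s * ⟪b, X.1 b⟫_ℂ + (starRingEnd ℂ) (β s) * β s * ⟪a, X.1 a⟫_ℂ +
      (starRingEnd ℂ) (α s) * β s * ⟪b, X.1 a⟫_ℂ + (starRingEnd ℂ) (β s) * α s * ⟪a, X.1 b⟫_ℂ := by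
    intro s X
    rw [hαβ, map_add, map_smul, map_smul, inner_add_left, inner_add_right, inner_add_right,
      inner_smul_left, inner_smul_left, inner_smul_left, inner_smul_left, inner_smul_right,
      inner_smul_right, inner_smul_right, inner_smul_right]
    ring
  obtain ⟨p, r, m, n, hψ⟩ : ∃ p r m n : ℂ, ∀ X : selfAdjoint (H →L[ℂ] H), ⟪e, (G X).1 x⟫_ℂ =
      p * ⟪a, X.1 a⟫_ℂ + r * ⟪b, X.1 b⟫_ℂ + m * ⟪a, X.1 b⟫_ℂ + n * ⟪b, X.1 a⟫_ℂ := by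
    -- Polarization: `c` extracts the coefficient of `conj s` and kills those of `1`, `s` and `s *
    -- conj s`.
    let c : (ℂ → ℂ) → ℂ := fun f =>
      (f 1 + Complex.I * f Complex.I - f (-1) - Complex.I * f (-Complex.I)) / 4
    refine ⟨c fun s => (starRingEnd ℂ) (β s) * β s, c fun s => (starRingEnd ℂ) (α s) * α s,
      c fun s => (starRingEnd ℂ) (β s) * α s, c fun s => (starRingEnd ℂ) (α s) * β s, fun X => ?_⟩
    have h1 := (hexp 1 X).symm.trans (inner_root_add hS x e 1 X)
    have h2 := (hexp Complex.I X).symm.trans (inner_root_add hS x e Complex.I X)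
    have h3 := (hexp (-1) X).symm.trans (inner_root_add hS x e (-1) X)
    have h4 := (hexp (-Complex.I) X).symm.trans (inner_root_add hS x e (-Complex.I) X)
    simp only [map_neg, map_one, Complex.conj_I] at h1 h2 h3 h4
    simp only [c]
    linear_combination -(1 / 4) * (h1 + Complex.I * h2 - h3 - Complex.I * h4) +
      (1 / 2) * (⟪e, (G X).1 x⟫_ℂ - (starRingEnd ℂ) ⟪e, (G X).1 x⟫_ℂ) * Complex.I_sq
  -- Comparing the two expansions of the form at `x + s • e`, by independence of the four
  -- functionals.
  have hcoef : ∀ s : ℂ, _ := fun s =>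
    sesqFunctional_independent hab hba
      (c₁ := (starRingEnd ℂ) (β s) * β s -
        (s * (starRingEnd ℂ) s + (starRingEnd ℂ) s * p + s * (starRingEnd ℂ) p))
      (c₂ := (starRingEnd ℂ) (α s) * α s - (1 + (starRingEnd ℂ) s * r + s * (starRingEnd ℂ) r))
      (c₃ := (starRingEnd ℂ) (β s) * α s - ((starRingEnd ℂ) s * m + s * (starRingEnd ℂ) n))
      (c₄ := (starRingEnd ℂ) (α s) * β s - (s * (starRingEnd ℂ) m + (starRingEnd ℂ) s * n))
      fun X => by
        have h1 := (hexp s X).symm.trans (inner_root_add hS x e s X)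
        have haa : (starRingEnd ℂ) ⟪a, X.1 a⟫_ℂ = ⟪a, X.1 a⟫_ℂ := by
          rw [inner_conj_symm]; exact X.2.isSymmetric a a
        have hbb : (starRingEnd ℂ) ⟪b, X.1 b⟫_ℂ = ⟪b, X.1 b⟫_ℂ := by
          rw [inner_conj_symm]; exact X.2.isSymmetric b b
        have hab : (starRingEnd ℂ) ⟪a, X.1 b⟫_ℂ = ⟪b, X.1 a⟫_ℂ := by
          rw [inner_conj_symm]; exact X.2.isSymmetric b a
        have hba : (starRingEnd ℂ) ⟪b, X.1 a⟫_ℂ = ⟪a, X.1 b⟫_ℂ := by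
          rw [inner_conj_symm]; exact X.2.isSymmetric a b
        rw [hψ X] at h1
        simp only [map_add, map_mul, haa, hbb, hab, hba] at h1
        linear_combination h1
  obtain ⟨rfl, rfl, h⟩ := coefficients_of_rank_one (p := p) (r := r) (m := m) (n := n) fun s => by
    obtain ⟨h1, h2, h3, h4⟩ := hcoef s
    rw [← sub_eq_zero.1 h1, ← sub_eq_zero.1 h2, ← sub_eq_zero.1 h3, ← sub_eq_zero.1 h4]
    ring
  rcases h with ⟨rfl, hm⟩ | ⟨rfl, hn⟩
  · exact .inl ⟨m, hm, fun X => by rw [hψ]; ring⟩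
  · exact .inr ⟨n, hn, fun X => by rw [hψ]; ring⟩

end Congruence

theorem submodule_eq_top_or_eq_top {U V : Submodule ℂ H} (h : ∀ x, x ∈ U ∨ x ∈ V) :
    U = ⊤ ∨ V = ⊤ := by
  by_contra! hn
  obtain ⟨x, -, hx⟩ := SetLike.exists_of_lt (lt_top_iff_ne_top.2 hn.1)
  obtain ⟨y, -, hy⟩ := SetLike.exists_of_lt (lt_top_iff_ne_top.2 hn.2)
  have hxV := (h x).resolve_left hx
  have hyU := (h y).resolve_right hy
  rcases h (x + y) with h1 | h1
  · exact hx ((Submodule.add_mem_iff_left U hyU).1 h1)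
  · exact hy ((Submodule.add_mem_iff_right V hxV).1 h1)

theorem eq_of_forall_inner_apply_eq {a u v : H} (ha : a ≠ 0)
    (h : ∀ X : selfAdjoint (H →L[ℂ] H), ⟪a, X.1 u⟫_ℂ = ⟪a, X.1 v⟫_ℂ) : u = v := by
  have h1 := forall_of_forall_selfAdjoint (L := sesqFunctional a u - sesqFunctional a v)
    (fun X => sub_eq_zero.2 (h X)) (InnerProductSpace.rankOne ℂ a (u - v))
  rw [LinearMap.sub_apply, sesqFunctional_rankOne, sesqFunctional_rankOne, ← sub_mul,
    ← inner_sub_right, mul_eq_zero, inner_self_eq_zero, inner_self_eq_zero] at h1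
  exact sub_eq_zero.1 (h1.resolve_right ha)

theorem eq_of_forall_inner_apply_eq' {a u v : H} (ha : a ≠ 0)
    (h : ∀ X : selfAdjoint (H →L[ℂ] H), ⟪u, X.1 a⟫_ℂ = ⟪v, X.1 a⟫_ℂ) : u = v := by
  refine eq_of_forall_inner_apply_eq ha fun X => ?_
  have hX : ∀ w, ⟪a, X.1 w⟫_ℂ = ⟪X.1 a, w⟫_ℂ := fun w => (X.2.isSymmetric a w).symm
  rw [hX, hX, ← inner_conj_symm, h X, inner_conj_symm]

section Congruence

variable {G : selfAdjoint (H →L[ℂ] H) → selfAdjoint (H →L[ℂ] H)} {S : H → H}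
  (hG : Function.Surjective G)
  (hS : ∀ (y : H) (X : selfAdjoint (H →L[ℂ] H)), ⟪y, (G X).1 y⟫_ℂ = ⟪S y, X.1 (S y)⟫_ℂ)

include hS in
theorem inner_smul_form (c : ℂ) (e : H) (X : selfAdjoint (H →L[ℂ] H)) :
    ⟪c • e, (G X).1 (c • e)⟫_ℂ = ⟪c • S e, X.1 (c • S e)⟫_ℂ := by
  rw [map_smul, map_smul, inner_smul_left, inner_smul_right, inner_smul_left, inner_smul_right, hS]

theorem inner_unit_smul_form {c : ℂ} (hc : ‖c‖ = 1) (b : H) (X : selfAdjoint (H →L[ℂ] H)) :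
    ⟪c • b, X.1 (c • b)⟫_ℂ = ⟪b, X.1 b⟫_ℂ := by
  rw [map_smul, inner_smul_left, inner_smul_right, ← mul_assoc, Complex.conj_mul', hc]
  simp

include hG hS

/-- The vectors `x` for which `⟪e, G(X) x⟫` has the linear, respectively the conjugate-linear, shape
form subspaces `U` and `V`. They cover the space, so one is everything. The representing vector is
unique, hence depends (conjugate-)linearly on `x`, and it differs from `S x` by a phase when `x ∉ ℂ
e`. -/
theorem exists_linear_congruence [Nontrivial H] :
    (∃ T : H →ₗ[ℂ] H, ∀ (y : H) (X : selfAdjoint (H →L[ℂ] H)),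
      ⟪y, (G X).1 y⟫_ℂ = ⟪T y, X.1 (T y)⟫_ℂ) ∨
    ∃ T : H →ₗ⋆[ℂ] H, ∀ (y : H) (X : selfAdjoint (H →L[ℂ] H)),
      ⟪y, (G X).1 y⟫_ℂ = ⟪T y, X.1 (T y)⟫_ℂ := by
  obtain ⟨e, he⟩ := exists_ne (0 : H)
  have ha : S e ≠ 0 := root_ne_zero hG hS he
  let U : Submodule ℂ H :=
    { carrier := {x | ∃ u, ∀ X, ⟪e, (G X).1 x⟫_ℂ = ⟪S e, X.1 u⟫_ℂ}
      zero_mem' := ⟨0, fun X => by simp⟩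
      add_mem' := by
        rintro x y ⟨u, hu⟩ ⟨v, hv⟩
        exact ⟨u + v, fun X => by
          rw [map_add, map_add, inner_add_right, inner_add_right, hu, hv]⟩
      smul_mem' := by
        rintro c x ⟨u, hu⟩
        exact ⟨c • u, fun X => by rw [map_smul, map_smul, inner_smul_right, inner_smul_right, hu]⟩ }
  let V : Submodule ℂ H :=
    { carrier := {x | ∃ u, ∀ X, ⟪e, (G X).1 x⟫_ℂ = ⟪u, X.1 (S e)⟫_ℂ}
      zero_mem' := ⟨0, fun X => by simp⟩
      add_mem' := by
        rintro x y ⟨u, hu⟩ ⟨v, hv⟩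
        exact ⟨u + v, fun X => by rw [map_add, inner_add_right, inner_add_left, hu, hv]⟩
      smul_mem' := by
        rintro c x ⟨u, hu⟩
        exact ⟨(starRingEnd ℂ) c • u, fun X => by
          rw [map_smul, inner_smul_right, inner_smul_left, hu, Complex.conj_conj]⟩ }
  have hscalar : ∀ x ∈ ℂ ∙ e, ∃ c : ℂ, x = c • e ∧
      ∀ X, ⟪e, (G X).1 x⟫_ℂ = c * ⟪S e, X.1 (S e)⟫_ℂ := by
    intro x hx
    obtain ⟨c, rfl⟩ := Submodule.mem_span_singleton.1 hx
    exact ⟨c, rfl, fun X => by rw [map_smul, inner_smul_right, hS]⟩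
  have hUV : ∀ x, x ∈ U ∨ x ∈ V := by
    intro x
    by_cases hx : x ∈ ℂ ∙ e
    · obtain ⟨c, -, hc⟩ := hscalar x hx
      exact .inl ⟨c • S e, fun X => by rw [hc, map_smul, inner_smul_right]⟩
    · rcases polar_form_eq hG hS he hx with ⟨m, -, hm⟩ | ⟨n, -, hn⟩
      · exact .inl ⟨m • S x, fun X => by rw [hm, map_smul, inner_smul_right]⟩
      · exact .inr ⟨(starRingEnd ℂ) n • S x, fun X => by
          rw [hn, inner_smul_left, Complex.conj_conj]⟩
  -- The two shapes are incompatible off the line `ℂ (S e)`: a rank-one operator with range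
  -- orthogonal to `S e` separates them.
  have hmixed : ∀ {u v : H}, u ∉ ℂ ∙ S e → ∀ {c : ℂ},
      (∀ X : selfAdjoint (H →L[ℂ] H), ⟪S e, X.1 v⟫_ℂ = c * ⟪u, X.1 (S e)⟫_ℂ) → c = 0 := by
    intro u v hu c h
    obtain ⟨f, huf, haf⟩ := exists_dual_vector hu
    have h1 := forall_of_forall_selfAdjoint (L := sesqFunctional (S e) v - c • sesqFunctional u (S e))
      (fun X => sub_eq_zero.2 (h X)) (InnerProductSpace.rankOne ℂ f (S e))
    rw [LinearMap.sub_apply, LinearMap.smul_apply, sesqFunctional_rankOne, sesqFunctional_rankOne,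
      haf, huf, mul_zero, zero_sub, neg_eq_zero, mul_one, smul_eq_mul, mul_eq_zero,
      inner_self_eq_zero] at h1
    exact h1.resolve_right ha
  rcases submodule_eq_top_or_eq_top hUV with hU | hV
  · left
    have hall : ∀ x, ∃ u, ∀ X, ⟪e, (G X).1 x⟫_ℂ = ⟪S e, X.1 u⟫_ℂ := fun x =>
      (hU ▸ Submodule.mem_top : x ∈ U)
    choose T hT using hall
    let T' : H →ₗ[ℂ] H :=
      { toFun := T
        map_add' := fun x y => eq_of_forall_inner_apply_eq ha fun X => by
          rw [← hT, map_add, map_add, inner_add_right, inner_add_right, hT, hT]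
        map_smul' := fun c x => eq_of_forall_inner_apply_eq ha fun X => by
          rw [← hT, map_smul, map_smul, inner_smul_right, inner_smul_right, hT, RingHom.id_apply] }
    refine ⟨T', fun y X => ?_⟩
    change _ = ⟪T y, X.1 (T y)⟫_ℂ
    by_cases hy : y ∈ ℂ ∙ e
    · obtain ⟨c, rfl, hc⟩ := hscalar y hy
      have : T (c • e) = c • S e := eq_of_forall_inner_apply_eq ha fun X => by
        rw [← hT, hc, map_smul, inner_smul_right]
      rw [this, inner_smul_form hS]
    · rcases polar_form_eq hG hS he hy with ⟨m, hm1, hm⟩ | ⟨n, hn1, hn⟩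
      · have : T y = m • S y := eq_of_forall_inner_apply_eq ha fun X => by
          rw [← hT, hm, map_smul, inner_smul_right]
        rw [this, inner_unit_smul_form hm1, hS]
      · have := hmixed (root_notMem_span hG hS hy) (v := T y) (c := n) fun X => by
          rw [← hT, hn]
        rw [this, norm_zero] at hn1
        exact absurd hn1 zero_ne_one
  · right
    have hall : ∀ x, ∃ u, ∀ X, ⟪e, (G X).1 x⟫_ℂ = ⟪u, X.1 (S e)⟫_ℂ := fun x =>
      (hV ▸ Submodule.mem_top : x ∈ V)
    choose T hT using hall
    let T' : H →ₗ⋆[ℂ] H :=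
      { toFun := T
        map_add' := fun x y => eq_of_forall_inner_apply_eq' ha fun X => by
          rw [← hT, map_add, inner_add_right, inner_add_left, hT, hT]
        map_smul' := fun c x => eq_of_forall_inner_apply_eq' ha fun X => by
          rw [← hT, map_smul, inner_smul_right, inner_smul_left, hT, Complex.conj_conj] }
    refine ⟨T', fun y X => ?_⟩
    change _ = ⟪T y, X.1 (T y)⟫_ℂ
    by_cases hy : y ∈ ℂ ∙ e
    · obtain ⟨c, rfl, hc⟩ := hscalar y hy
      have : T (c • e) = (starRingEnd ℂ) c • S e := eq_of_forall_inner_apply_eq' ha fun X => by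
        rw [← hT, hc, inner_smul_left, Complex.conj_conj]
      rw [this, map_smul, map_smul, inner_smul_left, inner_smul_left, inner_smul_right,
        inner_smul_right, Complex.conj_conj, hS]
      ring
    · rcases polar_form_eq hG hS he hy with ⟨m, hm1, hm⟩ | ⟨n, hn1, hn⟩
      · have hm0 : m ≠ 0 := by
          rintro rfl
          rw [norm_zero] at hm1
          exact zero_ne_one hm1
        have hne : T y ∉ ℂ ∙ S e := by
          intro h
          obtain ⟨c, hc⟩ := Submodule.mem_span_singleton.1 h
          have h1 : m • S y = (starRingEnd ℂ) c • S e := eq_of_forall_inner_apply_eq ha fun X => by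
            rw [map_smul, inner_smul_right, ← hm, hT, ← hc, inner_smul_left, map_smul,
              inner_smul_right]
          refine root_notMem_span hG hS hy (Submodule.mem_span_singleton.2
            ⟨m⁻¹ * (starRingEnd ℂ) c, ?_⟩)
          rw [mul_smul, ← h1, smul_smul, inv_mul_cancel₀ hm0, one_smul]
        have := hmixed hne (v := S y) (c := m⁻¹) fun X => by
          rw [← hT, hm, inv_mul_cancel_left₀ hm0]
        exact absurd this (inv_ne_zero hm0)
      · have : T y = (starRingEnd ℂ) n • S y := eq_of_forall_inner_apply_eq' ha fun X => by
          rw [← hT, hn, inner_smul_left, Complex.conj_conj]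
        rw [this, inner_unit_smul_form (by rwa [RCLike.norm_conj]), hS]

end Congruence

/-! ### Adjoints and assembly of the theorem. -/

theorem continuous_of_conjLinear (f : H →ₗ⋆[ℂ] H) : Continuous f := by
  have : FiniteDimensional ℝ H := FiniteDimensional.complexToReal H
  let g : H →ₗ[ℝ] H :=
    { toFun := f
      map_add' := map_add f
      map_smul' := fun c x => by
        rw [← Complex.coe_smul, map_smulₛₗ, Complex.conj_ofReal, Complex.coe_smul]; rfl }
  exact g.continuous_of_finiteDimensional

theorem bijective_of_conjLinear_injective (f : H →ₗ⋆[ℂ] H) (hf : Function.Injective f) :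
    Function.Bijective f := by
  have : FiniteDimensional ℝ H := FiniteDimensional.complexToReal H
  let g : H →ₗ[ℝ] H :=
    { toFun := f
      map_add' := map_add f
      map_smul' := fun c x => by
        rw [← Complex.coe_smul, map_smulₛₗ, Complex.conj_ofReal, Complex.coe_smul]; rfl }
  exact ⟨hf, (LinearMap.injective_iff_surjective (f := g)).1 hf⟩

/-- An injective conjugate-linear operator as a continuous conjugate-linear equivalence. -/
def conjEquivOfInjective (f : H →ₗ⋆[ℂ] H) (hf : Function.Injective f) : H ≃L⋆[ℂ] H where
  toLinearEquiv := LinearEquiv.ofBijective f (bijective_of_conjLinear_injective f hf)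
  continuous_toFun := continuous_of_conjLinear f
  continuous_invFun := continuous_of_conjLinear
    (LinearEquiv.ofBijective f (bijective_of_conjLinear_injective f hf)).symm.toLinearMap

theorem conjAdjoint_conjAdjoint (T : H →L⋆[ℂ] H) : conjAdjoint (conjAdjoint T) = T := by
  ext y
  refine ext_inner_right ℂ fun x => ?_
  rw [conjAdjoint_inner, ← inner_conj_symm, ← conjAdjoint_inner T y x, inner_conj_symm]

/-- With `g` adjoint to `f`: `y` is orthogonal to `g (ker B)` iff `f y` is orthogonal to `ker B`.
Vanishing inner products alone are compared, so the linear and conjugate-linear cases are treated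
together. -/
theorem orthogonal_map_ker_eq_of_inner {B C : H →L[ℂ] H} {N : Submodule ℂ H} {f g : H → H}
    (hN : ∀ y, y ∈ N ↔ ∃ k ∈ LinearMap.ker (B : H →ₗ[ℂ] H), g k = y)
    (hadj : ∀ k y, ⟪g k, y⟫_ℂ = 0 ↔ ⟪k, f y⟫_ℂ = 0)
    (hsupp : ∀ y, y ∈ supp C ↔ f y ∈ supp B) : Nᗮ = supp C := by
  ext y
  rw [hsupp, supp, Submodule.mem_orthogonal, Submodule.mem_orthogonal]
  constructor
  · intro h k hk
    exact (hadj k y).1 (h _ ((hN _).2 ⟨k, hk, rfl⟩))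
  · intro h u hu
    obtain ⟨k, hk, rfl⟩ := (hN _).1 hu
    exact (hadj k y).2 (h k hk)

section Map

variable {φ : PSD H → PSD H} (hbij : Function.Bijective φ)
  (hmean : ∀ A B : PSD H, φ (mean A B) = mean (φ A) (φ B))

/-- The map induced by `φ` on the logarithms of invertible operators, normalized at `0`. -/
def logMap (φ : PSD H → PSD H) (X : selfAdjoint (H →L[ℂ] H)) : selfAdjoint (H →L[ℂ] H) :=
  saLog (φ (ofLog ⊤ X)).1 - saLog (φ PSD.one).1

include hbij hmean

theorem logMap_surjective : Function.Surjective (logMap φ) := by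
  intro Z
  obtain ⟨A, hA⟩ := hbij.2 (ofLog ⊤ (Z + saLog (φ PSD.one).1))
  have hs : supp A.1 = ⊤ := by rw [← supp_map_eq_top_iff hbij hmean, hA, supp_ofLog]
  have hA' : A = ofLog ⊤ (saLog A.1) := by
    refine PSD.ext_log (by rw [supp_ofLog, hs]) ?_
    rw [logHat_ofLog, compress_top]
    rfl
  refine ⟨saLog A.1, ?_⟩
  rw [logMap, ← hA', hA, sub_eq_iff_eq_add]
  ext1
  exact (logHat_ofLog _ _).trans (compress_top _)

/-- The diagonal form determines `Z`, so `log φ(A)` is the compression of `log φ(I) + Z` to `supp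
φ(A)`, and `isLogProduct_expOn` applies. -/
theorem isLogProduct_compressedExp {A : PSD H} {N : Submodule ℂ H} {Z : H →L[ℂ] H}
    (hZ : ∀ y, ⟪y, (logMap φ (saLog A.1)).1 y⟫_ℂ = ⟪y, Z y⟫_ℂ) (hN : Nᗮ = supp (φ A).1) :
    IsLogProduct (φ PSD.one).1 (compressedExp N Z) (φ A).1 := by
  have hZ' : (logMap φ (saLog A.1)).1 = Z := by
    have : ((logMap φ (saLog A.1)).1 : H →ₗ[ℂ] H) = Z := by
      refine (ext_inner_map _ _).1 fun y => ?_
      simp only [ContinuousLinearMap.coe_coe]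
      rw [← inner_conj_symm, hZ, inner_conj_symm]
    ext y
    exact LinearMap.congr_fun this y
  have hone : expOn ⊤ (logHat (φ PSD.one).1) = (φ PSD.one).1 := by
    rw [← (supp_map_eq_top_iff hbij hmean (A := PSD.one)).2, expOn_logHat (φ PSD.one).2]
    rw [← ofLog_top_zero, supp_ofLog]
  have hadd : logHat (φ (ofLog ⊤ (saLog A.1))).1 = logHat (φ PSD.one).1 + Z := by
    rw [← hZ', logMap]
    exact (add_sub_cancel (logHat (φ PSD.one).1) (logHat (φ (ofLog ⊤ (saLog A.1))).1)).symm
  have hφA : (φ A).1 = expOn Nᗮ (logHat (φ PSD.one).1 + Z) := by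
    rw [hN, ← hadd, ← expOn_compress,
      ← logHat_map_eq_compress hbij hmean (X := saLog A.1) (compress_logHat A.2),
      expOn_logHat (φ A).2]
  have h := isLogProduct_expOn Nᗮ (logHat_isSelfAdjoint (φ PSD.one).1)
    (hZ' ▸ (logMap φ (saLog A.1)).2 : IsSelfAdjoint Z)
  rw [hone, ← hφA] at h
  exact h

end Map

theorem exists_transform_of_map_mean [Nontrivial H] {φ : PSD H → PSD H}
    (hbij : Function.Bijective φ) (hmean : ∀ A B : PSD H, φ (mean A B) = mean (φ A) (φ B))
    (hcont : ContinuousAt φ PSD.zero) :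
    (∃ T : H ≃L[ℂ] H, ∀ A : PSD H,
      IsLogProduct (φ PSD.one).1 (linTransform T A.1) (φ A).1) ∨
    ∃ T : H ≃L⋆[ℂ] H, ∀ A : PSD H,
      IsLogProduct (φ PSD.one).1 (conjTransform T A.1) (φ A).1 := by
  have hex : ∀ y : H, ∃ s : H, (∀ A : PSD H, y ∈ supp (φ A).1 ↔ s ∈ supp A.1) ∧
      ∀ X : selfAdjoint (H →L[ℂ] H), ⟪y, (logMap φ X).1 y⟫_ℂ = ⟪s, X.1 s⟫_ℂ := by
    intro y
    rcases eq_or_ne y 0 with rfl | hy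
    · exact ⟨0, fun A => by simp, fun X => by simp⟩
    · exact exists_inner_logHat_map hbij hmean hcont hy
  choose S hsupp hS using hex
  have hsurj := logMap_surjective hbij hmean
  -- Another root `f` of the same forms is proportional to `S` at each vector, so it sees the same
  -- supports.
  have hsupp' : ∀ {f : H → H}, (∀ (y : H) (X : selfAdjoint (H →L[ℂ] H)),
      ⟪y, (logMap φ X).1 y⟫_ℂ = ⟪f y, X.1 (f y)⟫_ℂ) → f 0 = 0 →
      ∀ (A : PSD H) (y : H), y ∈ supp (φ A).1 ↔ f y ∈ supp A.1 := by
    intro f hf hf0 A y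
    rcases eq_or_ne y 0 with rfl | hy
    · simp [hf0]
    · obtain ⟨z, hz, hfz⟩ := exists_smul_eq_of_forall_inner_eq (root_ne_zero hsurj hS hy)
        (u := f y) fun X => by rw [← hf, ← hS]
      rw [hsupp, hfz, Submodule.smul_mem_iff _ hz]
  rcases exists_linear_congruence hsurj hS with ⟨T, hT⟩ | ⟨T, hT⟩
  · left
    have hker : ∀ y, T y = 0 → y = 0 := fun y hy => by
      by_contra hne
      exact root_ne_zero hsurj hT hne hy
    set E : H →L[ℂ] H := LinearMap.toContinuousLinearMap T with hE
    have hinj : Function.Injective (ContinuousLinearMap.adjoint E : H →ₗ[ℂ] H) := by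
      have hTs : Function.Surjective T :=
        LinearMap.injective_iff_surjective.1 ((injective_iff_map_eq_zero T).2 hker)
      refine (injective_iff_map_eq_zero _).2 fun y hy => ?_
      obtain ⟨x, rfl⟩ := hTs y
      have h1 := ContinuousLinearMap.adjoint_inner_left E x (T x)
      rw [show ContinuousLinearMap.adjoint E (T x) = 0 from hy, inner_zero_left] at h1
      exact inner_self_eq_zero.1 h1.symm
    -- The form `⟪T y, X (T y)⟫` is that of `T* X T`, so the operator sought is the adjoint of `T`.
    let R : H ≃L[ℂ] H := (LinearEquiv.ofInjectiveEndo _ hinj).toContinuousLinearEquiv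
    have hR : (R : H →L[ℂ] H) = ContinuousLinearMap.adjoint E := by ext y; rfl
    refine ⟨R, fun A => ?_⟩
    refine isLogProduct_compressedExp hbij hmean (fun y => ?_) ?_
    · rw [hR, ContinuousLinearMap.adjoint_adjoint]
      simp only [ContinuousLinearMap.comp_apply]
      rw [ContinuousLinearMap.adjoint_inner_right]
      exact hT y (saLog A.1)
    · refine orthogonal_map_ker_eq_of_inner (f := T) (g := R) (fun y => Submodule.mem_map)
        (fun k y => ?_) (hsupp' hT (map_zero T) A)
      have : R k = ContinuousLinearMap.adjoint E k := rfl
      rw [this, ContinuousLinearMap.adjoint_inner_left]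
      rfl
  · right
    have hker : ∀ y, T y = 0 → y = 0 := fun y hy => by
      by_contra hne
      exact root_ne_zero hsurj hT hne hy
    let E : H →L⋆[ℂ] H := ⟨T, continuous_of_conjLinear T⟩
    have hinj : Function.Injective (conjAdjoint E).toLinearMap := by
      have hTs : Function.Surjective T :=
        (bijective_of_conjLinear_injective T ((injective_iff_map_eq_zero T).2 hker)).2
      refine (injective_iff_map_eq_zero _).2 fun y hy => ?_
      obtain ⟨x, rfl⟩ := hTs y
      have h1 := conjAdjoint_inner E x (T x)
      rw [show conjAdjoint E (T x) = 0 from hy, inner_zero_left] at h1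
      exact inner_self_eq_zero.1 h1.symm
    let R : H ≃L⋆[ℂ] H := conjEquivOfInjective _ hinj
    have hR : (R : H →L⋆[ℂ] H) = conjAdjoint E := by ext y; rfl
    refine ⟨R, fun A => ?_⟩
    refine isLogProduct_compressedExp hbij hmean (fun y => ?_) ?_
    · rw [hR, conjAdjoint_conjAdjoint]
      simp only [ContinuousLinearMap.comp_apply]
      rw [hT, ← inner_conj_symm y (conjAdjoint E _), conjAdjoint_inner, inner_conj_symm]
      exact ((saLog A.1).2.isSymmetric (T y) (T y)).symm
    · refine orthogonal_map_ker_eq_of_inner (f := T) (g := R) (fun y => Submodule.mem_map)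
        (fun k y => ?_) (hsupp' hT (map_zero T) A)
      have : R k = conjAdjoint E k := rfl
      rw [this, conjAdjoint_inner, inner_eq_zero_symm]
      rfl

end LogEuclidean

end

theorem theorem3 {H : Type*} [NormedAddCommGroup H] [InnerProductSpace ℂ H] [CompleteSpace H]
    [FiniteDimensional ℂ H] (hd : 2 ≤ Module.finrank ℂ H)
    (φ : LogEuclidean.PSD H → LogEuclidean.PSD H) (hbij : Function.Bijective φ)
    (hmean : ∀ A B : LogEuclidean.PSD H,
      φ (LogEuclidean.mean A B) = LogEuclidean.mean (φ A) (φ B))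
    (hcont : ContinuousAt φ LogEuclidean.PSD.zero) :
    (∃ T : H ≃L[ℂ] H, ∀ A : LogEuclidean.PSD H,
      LogEuclidean.IsLogProduct (φ LogEuclidean.PSD.one).1
        (LogEuclidean.linTransform T A.1) (φ A).1) ∨
    (∃ T : H ≃L⋆[ℂ] H, ∀ A : LogEuclidean.PSD H,
      LogEuclidean.IsLogProduct (φ LogEuclidean.PSD.one).1
        (LogEuclidean.conjTransform T A.1) (φ A).1) := by
  have : Nontrivial H := Module.nontrivial_of_finrank_pos (R := ℂ) (by omega)
  exact LogEuclidean.exists_transform_of_map_mean hbij hmean hcont
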